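/- **Setting.** Logarithms are to base 2, $\log s:=-\infty$ for $s\le 0$, and $0\cdot(-\infty):=0$. Let $\mathcal X,\mathcal Y$ be finite input sets, $\mathcal A_x,\mathcal B_y$ ($x\in\mathcal X,y\in\mathcal Y$) subsets of output alphabets (that of Alice finite, all $\mathcal B_y$ finite), $\mathcal X_K,\mathcal X_T\subseteq\mathcal X$, $\mathcal Y_K,\mathcal Y_T\subseteq\mathcal Y$. In a round a test bit $T$ is drawn with $\mathrm P(T=1)=\gamma\in[0,1)$; if $T=0$ the inputs $(X,Y)$ are drawn from a fixed distribution on $\mathcal X_K\times\mathcal Y_K$, if $T=1$ from a fixed distribution on $\mathcal X_T\times\mathcal Y_T$. The test datum is $\bar C=f(a,b,x,y,t)$ with values in a finite set $\mathcal C\cup\{\perp\}$; it is $\perp$ if $t=0$ and lies in $\mathcal C$ if $t=1$. For POVMs $\{M_{a|x}\}_{a\in\mathcal A_x}$ on $Q_A$, $\{N_{b|y}\}_{b\in\mathcal B_y}$ on $Q_B$ and a normalised state $\sigma$ on $Q_A\otimes Q_B\otimes E$ (finite-dimensional systems) let $$\mathcal M(\sigma)=\sum_{x,y,t}\mathrm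 P(x,y,t)\sum_{a,b}|a,\bar c,x,y,t\rangle\langle a,\bar c,x,y,t|\otimes\mathrm{Tr}_{Q_AQ_B}\big[(M_{a|x}\otimes N_{b|y}\otimes 1)\sigma\big],\qquad \bar c=f(a,b,x,y,t),$$ let $\mathcal M(\sigma)_{\bar C}$ be the distribution of $\bar C$, and let $H_\alpha(A|T=0,XE)_{\mathcal M(\sigma)}$ be the Petz–Rényi conditional entropy $H_\alpha(A|B)_\rho=-D_\alpha(\rho_{AB}\|1_A\otimes\rho_B)$ of the state conditioned on $T=0$ and reduced to $A$ and $B=XE$, where $D_\alpha(\rho\|\sigma)=\frac1{\alpha-1}\log\frac{\mathrm{Tr}[\rho^\alpha\sigma^{1-\alpha}]}{\mathrm{Tr}\rho}$ for $\alpha>1$ if $\ker\sigma\subseteq\ker\rho$, and $+\infty$ otherwise. Let $D(q\|p)=\sum_{\bar c}q(\bar c)\log\frac{q(\bar c)}{p(\bar c)}$, where a summand is $0$ if $q(\bar c)=0\le p(\bar c)$ and $+\infty$ if $q(\bar c)>0\ge p(\bar c)$ or $p(\bar c)<0$ ($p$ need not be normalised). Let $S_\Omega$ be any set of probability distributions on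 $\mathcal C\cup\{\perp\}$ and $q_{\min}(\perp)=\inf_{q\in S_\Omega}q(\perp)$. **Quadrature.** Let $m\ge1$ and $\alpha\in(1,2)$. Let $t_1<\dots<t_m=1$ and $w_1,\dots,w_m$ be nodes and weights of the $m$-point Gauss–Radau–Jacobi quadrature, i.e. $\int_0^1p(s)s^{\alpha-1}(1-s)^{1-\alpha}ds=\sum_iw_ip(t_i)$ for all real polynomials $p$ of degree at most $2m-2$. **NPA relaxation.** Consider noncommuting variables $M_{a|x}=M_{a|x}^\dagger$, $N_{b|y}=N_{b|y}^\dagger$ and $Z_{a,i}^x,Z_{a,i}^{x\dagger}$ ($x\in\mathcal X_K$, $a\in\mathcal A_x$, $1\le i\le m$), the polynomials $$p_{\bar c}=\sum_{a,b,x,y,t:\,f(a,b,x,y,t)=\bar c}\mathrm P(x,y,t)M_{a|x}N_{b|y},\qquad G=\sum_{x\in\mathcal X_K}\mathrm P(x|T=0)\sum_{a\in\mathcal A_x}\big(M_{a|x}P_{a,x}+Q_{a,x}\big),$$ $$P_{a,x}=1+\tfrac{\sin(\alpha\pi)}{\pi}\sum_i\tfrac{w_i}{t_i}\big(1+Z^x_{a,i}+Z^{x\dagger}_{a,i}+(1-t_i)Z^{x\dagger}_{a,i}Z^x_{a,i}\big),\qquad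 Q_{a,x}=\tfrac{\sin(\alpha\pi)}{\pi}\sum_iw_iZ^x_{a,i}Z^{x\dagger}_{a,i},$$ and the constraints $M_{a|x}\succeq0$, $N_{b|y}\succeq0$, $\sum_aM_{a|x}-1=0$, $\sum_bN_{b|y}-1=0$, $[M_{a|x},N_{b|y}]=0$, $[M_{a|x},Z]=[N_{b|y},Z]=0$ for $Z$ any $Z^{x'}_{a',i}$ or $Z^{x'\dagger}_{a',i}$, and, optionally, $M_{a|x}^2=M_{a|x}$, $N_{b|y}^2=N_{b|y}$; every equation $r=0$ is read as the two constraints $r\succeq0$, $-r\succeq0$. An NPA relaxation consists of finite sets $\mathcal S_k$ of monomials, one for each constraint $k_0:=1\succeq0$ (giving the moment matrix) and each constraint $k\succeq0$ in the list (an empty set means that the constraint is not used), and a finite set $W\ni1$ of monomials containing all monomials of all $p_{\bar c}$, of $G$, and of $u^\dagger kv$ for $u,v\in\mathcal S_k$. It has one real variable $y_u$ for each $u\in W$ (so $N=|W|$). For a polynomial $p=\sum_up_uu$ put $L_y(p)=\sum_{u\in W}p_uy_u$. The relaxation generates the linear functions $f_{\bar c}(y)=L_y(p_{\bar c})$ and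 $g(y)=L_y(G)$ and the block-diagonal matrix $M(y)$ with blocks $\big(L_y(u^\dagger kv)\big)_{u,v\in\mathcal S_k}$, whose entries are linear in $y$. **Theorem.** For all $\alpha\in(1,2)$ and $m\ge1$ the quadrature above exists, and its nodes and weights satisfy $t_i\in(0,1]$, $w_i>0$. For every NPA relaxation formed with such $t_i$, $w_i$, the quantity $$\inf_{\{M_{a|x}\},\{N_{b|y}\}}\ \inf_{q\in S_\Omega}\ \inf_{\sigma\in S_=(Q_AQ_BE)}\ \tfrac1{\alpha-1}D\big(q\,\|\,\mathcal M(\sigma)_{\bar C}\big)+q_{\min}(\perp)\,H_\alpha(A|T=0,XE)_{\mathcal M(\sigma)},$$ where the infimum is over devices and normalised states of all finite dimensions, is bounded from below by $$\inf_{q,\,y}\ \tfrac1{\alpha-1}D\big(q\,\|\,f(y)\big)+\tfrac{q_{\min}(\perp)}{1-\alpha}\log g(y)\quad\text{s.t.}\quad y_1=1,\ M(y)\succeq0,\ q\in S_\Omega,$$ where $y_1$ is the variable of the monomial $1$. If $S_\Omega$ is convex, the latter is a convex optimization problem (convex feasible set and convex extended-real-valued objective). -/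

import Mathlib

open scoped Kronecker ComplexOrder

noncomputable section

/-! ### Entropies of finite-dimensional states (all logarithms are to base two) -/

/-- The base-two logarithm as an extended-real concave function: `-∞` outside `(0, ∞)`. -/
def elogTwo (s : ℝ) : EReal :=
  if 0 < s then ((Real.logb 2 s : ℝ) : EReal) else ⊥

/-- One summand `q log (q / p)` of the relative entropy, with its usual extended values:
`0` if `q = 0 ≤ p`, and `+∞` if `q > 0` and `p ≤ 0` (or if an argument is negative). -/
def relEntropyTerm (q p : ℝ) : EReal :=
  if 0 < q ∧ 0 < p then ((q * Real.logb 2 (q / p) : ℝ) : EReal)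
  else if q = 0 ∧ 0 ≤ p then 0
  else ⊤

/-- The classical relative entropy `D(q ‖ p) = ∑ c, q c * log (q c / p c)`. The second argument
need not be normalised. -/
def relEntropy {ι : Type*} [Fintype ι] (q p : ι → ℝ) : EReal :=
  ∑ c, relEntropyTerm (q c) (p c)

/-- Real powers of a positive semidefinite matrix, through its spectral decomposition. A zero
eigenvalue stays zero for every nonzero exponent (powers on the support, pseudo-inverse). -/
def matPow {n : Type*} [Fintype n] [DecidableEq n] (ρ : Matrix n n ℂ) (s : ℝ) : Matrix n n ℂ :=
  cfc (fun u : ℝ => u ^ s) ρ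

open scoped Classical in
/-- The Petz-Rényi divergence `D_α(ρ ‖ σ)` of positive semidefinite matrices. -/
def petzDivergence {n : Type*} [Fintype n] [DecidableEq n] (α : ℝ) (ρ σ : Matrix n n ℂ) : EReal :=
  if (α < 1 ∧ ¬ (ρ * σ = 0 ∧ σ * ρ = 0)) ∨
      (∀ v : n → ℂ, Matrix.mulVec σ v = 0 → Matrix.mulVec ρ v = 0) then
    ((1 / (α - 1) *
      Real.logb 2 ((matPow ρ α * matPow σ (1 - α)).trace.re / ρ.trace.re) : ℝ) : EReal)
  else ⊤

/-- The reduced state on the second factor. -/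
def reduceRight {n k : Type*} [Fintype n] (ρ : Matrix (n × k) (n × k) ℂ) : Matrix k k ℂ :=
  fun e e' => ∑ i, ρ (i, e) (i, e')

/-- The Petz-Rényi conditional entropy `H_α(A|B)_ρ = - D_α(ρ_{AB} ‖ 1_A ⊗ ρ_B)`. -/
def petzCondEntropy {n k : Type*} [Fintype n] [DecidableEq n] [Fintype k] [DecidableEq k]
    (α : ℝ) (ρ : Matrix (n × k) (n × k) ℂ) : EReal :=
  - petzDivergence α ρ ((1 : Matrix n n ℂ) ⊗ₖ reduceRight ρ)

/-! ### The protocol, the devices and the single-round map -/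

/-- The public data of one round. `X`, `Y` are the input alphabets, `A`, `B` contain all outputs,
`outA x`, `outB y` are the outputs possible on the given input. The test bit is `true` (a test
round) with probability `γ`; key rounds and test rounds have their own input distributions. In
test rounds the recorded datum is `testFn a b x y`. -/
structure Protocol (X Y A B C : Type*) [Fintype X] [Fintype Y] where
  keyX : Finset X
  keyY : Finset Y
  testX : Finset X
  testY : Finset Y
  outA : X → Finset A
  outB : Y → Finset B
  γ : ℝ
  γ_nonneg : 0 ≤ γ
  γ_lt_one : γ < 1
  keyDist : X × Y → ℝ
  keyDist_mem : keyDist ∈ stdSimplex ℝ (X × Y)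
  keyDist_support : ∀ x y, keyDist (x, y) ≠ 0 → x ∈ keyX ∧ y ∈ keyY
  testDist : X × Y → ℝ
  testDist_mem : testDist ∈ stdSimplex ℝ (X × Y)
  testDist_support : ∀ x y, testDist (x, y) ≠ 0 → x ∈ testX ∧ y ∈ testY
  testFn : A → B → X → Y → C

namespace Protocol

variable {X Y A B C : Type*} [Fintype X] [Fintype Y] (P : Protocol X Y A B C)

/-- `P(X = x, Y = y, T = t)`. -/
def inputProb (x : X) (y : Y) (t : Bool) : ℝ :=
  if t = true then P.γ * P.testDist (x, y) else (1 - P.γ) * P.keyDist (x, y)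

/-- `P(X = x | T = 0)`. -/
def keyProb (x : X) : ℝ := ∑ y, P.keyDist (x, y)

/-- The test data of a round; `none` is the symbol `⊥` of a key-generating round. -/
def testData (a : A) (b : B) (x : X) (y : Y) (t : Bool) : Option C :=
  if t = true then some (P.testFn a b x y) else none

/-- The measurements of Alice and Bob: a POVM for every input, on systems of dimensions
`dA` and `dB`. -/
structure Device (dA dB : ℕ) where
  M : (x : X) → P.outA x → Matrix (Fin dA) (Fin dA) ℂ
  N : (y : Y) → P.outB y → Matrix (Fin dB) (Fin dB) ℂ
  M_pos : ∀ x a, (M x a).PosSemidef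
  N_pos : ∀ y b, (N y b).PosSemidef
  M_sum : ∀ x, ∑ a, M x a = 1
  N_sum : ∀ y, ∑ b, N y b = 1

end Protocol

/-- The normalised states on `Q_A ⊗ Q_B ⊗ E`. -/
def NormalizedState (dA dB dE : ℕ) : Type :=
  {σ : Matrix (Fin dA × Fin dB × Fin dE) (Fin dA × Fin dB × Fin dE) ℂ //
    σ.PosSemidef ∧ σ.trace = 1}

/-- The partial trace over `Q_A Q_B`. -/
def traceOutAB {dA dB dE : ℕ}
    (τ : Matrix (Fin dA × Fin dB × Fin dE) (Fin dA × Fin dB × Fin dE) ℂ) :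
    Matrix (Fin dE) (Fin dE) ℂ :=
  fun e e' => ∑ i, ∑ j, τ (i, j, e) (i, j, e')

/-- The classical registers `A`, `C`, `X`, `Y`, `T` of the output of a round. -/
abbrev ClassicalReg (X Y A C : Type*) := A × Option C × X × Y × Bool

namespace Protocol

variable {X Y A B C : Type*} [Fintype X] [DecidableEq X] [Fintype Y] [DecidableEq Y]
  [Fintype A] [DecidableEq A] [Fintype C] [DecidableEq C]

/-- The output state of the single-round map on the classical registers and `E`:
`∑ P(x,y,t) |a,c,x,y,t⟩⟨a,c,x,y,t| ⊗ Tr_{Q_A Q_B} [(M_{a|x} ⊗ N_{b|y} ⊗ 1) σ]`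
with `c = f(a,b,x,y,t)`. -/
def roundOutput (P : Protocol X Y A B C) {dA dB dE : ℕ} (𝒟 : P.Device dA dB)
    (σ : NormalizedState dA dB dE) :
    Matrix (ClassicalReg X Y A C × Fin dE) (ClassicalReg X Y A C × Fin dE) ℂ :=
  ∑ x : X, ∑ y : Y, ∑ t : Bool, ∑ a : P.outA x, ∑ b : P.outB y,
    (P.inputProb x y t : ℂ) •
      (Matrix.single (a.1, P.testData a.1 b.1 x y t, x, y, t)
          (a.1, P.testData a.1 b.1 x y t, x, y, t) (1 : ℂ) ⊗ₖ
        traceOutAB ((𝒟.M x a ⊗ₖ (𝒟.N y b ⊗ₖ (1 : Matrix (Fin dE) (Fin dE) ℂ))) * σ.1))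

end Protocol

section Registers

variable {X Y A C : Type*} [Fintype X] [Fintype Y] [Fintype A] [Fintype C] {dE : ℕ}

/-- The classical distribution of the test-data register. -/
def testDataDist
    (ρ : Matrix (ClassicalReg X Y A C × Fin dE) (ClassicalReg X Y A C × Fin dE) ℂ)
    (c : Option C) : ℝ :=
  ∑ a : A, ∑ x : X, ∑ y : Y, ∑ t : Bool, ∑ e : Fin dE,
    (ρ ((a, c, x, y, t), e) ((a, c, x, y, t), e)).re

/-- The partial state of the event `T = 0`. -/
def partialKey
    (ρ : Matrix (ClassicalReg X Y A C × Fin dE) (ClassicalReg X Y A C × Fin dE) ℂ) :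
    Matrix (ClassicalReg X Y A C × Fin dE) (ClassicalReg X Y A C × Fin dE) ℂ :=
  fun r s => if r.1.2.2.2.2 = false ∧ s.1.2.2.2.2 = false then ρ r s else 0

/-- The conditional state given `T = 0`. -/
def conditionKey
    (ρ : Matrix (ClassicalReg X Y A C × Fin dE) (ClassicalReg X Y A C × Fin dE) ℂ) :
    Matrix (ClassicalReg X Y A C × Fin dE) (ClassicalReg X Y A C × Fin dE) ℂ :=
  (ρ.trace / (partialKey ρ).trace) • partialKey ρ

/-- The reduced state on `A` and `X E`. -/
def reduceAXE
    (ρ : Matrix (ClassicalReg X Y A C × Fin dE) (ClassicalReg X Y A C × Fin dE) ℂ) :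
    Matrix (A × (X × Fin dE)) (A × (X × Fin dE)) ℂ :=
  fun r s => ∑ c : Option C, ∑ y : Y, ∑ t : Bool,
    ρ ((r.1, c, r.2.1, y, t), r.2.2) ((s.1, c, s.2.1, y, t), s.2.2)

/-- `H_α(A | T = 0, X E)`. -/
def keyEntropy [DecidableEq X] [DecidableEq A] (α : ℝ)
    (ρ : Matrix (ClassicalReg X Y A C × Fin dE) (ClassicalReg X Y A C × Fin dE) ℂ) : EReal :=
  petzCondEntropy α (reduceAXE (conditionKey ρ))

end Registers

/-- The least weight of `⊥` in the acceptance set. -/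
def qMin {C : Type*} (SΩ : Set (Option C → ℝ)) : ℝ :=
  sInf ((fun q : Option C → ℝ => q none) '' SΩ)

namespace Protocol

variable {X Y A B C : Type*} [Fintype X] [DecidableEq X] [Fintype Y] [DecidableEq Y]
  [Fintype A] [DecidableEq A] [Fintype C] [DecidableEq C]

/-- The simplified single-round objective, at a device, a distribution and a state. -/
def roundObjective (P : Protocol X Y A B C) (α : ℝ) (SΩ : Set (Option C → ℝ)) {dA dB dE : ℕ}
    (𝒟 : P.Device dA dB) (q : Option C → ℝ) (σ : NormalizedState dA dB dE) : EReal :=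
  ((1 / (α - 1) : ℝ) : EReal) * relEntropy q (testDataDist (P.roundOutput 𝒟 σ)) +
    ((qMin SΩ : ℝ) : EReal) * keyEntropy α (P.roundOutput 𝒟 σ)

/-- The infimum of the simplified objective over all devices (of all finite dimensions), all
accepted distributions and all normalised states. -/
def roundValue (P : Protocol X Y A B C) (α : ℝ) (SΩ : Set (Option C → ℝ)) : EReal :=
  ⨅ (dA : ℕ) (dB : ℕ) (dE : ℕ) (𝒟 : P.Device dA dB) (q ∈ SΩ) (σ : NormalizedState dA dB dE),
    P.roundObjective α SΩ 𝒟 q σ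

end Protocol

/-! ### The quadrature -/

/-- `t`, `w` are the nodes and weights of the `m`-point Gauss-Radau-Jacobi quadrature on `[0,1]`
with weight function `s^(α-1) (1-s)^(1-α)` and prescribed last node `1`: the rule is exact for
all polynomials of degree at most `2m - 2`. -/
structure IsGaussRadauJacobi (α : ℝ) {m : ℕ} (t w : Fin m → ℝ) : Prop where
  strictMono : StrictMono t
  last_eq_one : ∀ i : Fin m, (i : ℕ) + 1 = m → t i = 1
  exact_on : ∀ p : Polynomial ℝ, p.natDegree + 2 ≤ 2 * m →
    ∫ s in (0 : ℝ)..1, p.eval s * (s ^ (α - 1) * (1 - s) ^ (1 - α)) = ∑ i, w i * p.eval (t i)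

/-! ### Noncommutative polynomials and the NPA relaxation -/

section NPA

variable {X Y A B C : Type*} [Fintype X] [Fintype Y]

/-- The noncommuting variables: `M_{a|x}`, `N_{b|y}`, `Z_{a,i}^x` and its adjoint, the last two
for key inputs `x` only. -/
inductive Letter (P : Protocol X Y A B C) (m : ℕ) : Type _
  | alice (x : X) (a : P.outA x)
  | bob (y : Y) (b : P.outB y)
  | eve (x : P.keyX) (a : P.outA x.1) (i : Fin m)
  | eveAdj (x : P.keyX) (a : P.outA x.1) (i : Fin m)

variable {P : Protocol X Y A B C} {m : ℕ}

/-- The adjoint of a variable; `M_{a|x}` and `N_{b|y}` are self-adjoint. -/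
def Letter.adj : Letter P m → Letter P m
  | .alice x a => .alice x a
  | .bob y b => .bob y b
  | .eve x a i => .eveAdj x a i
  | .eveAdj x a i => .eve x a i

variable (P m) in
/-- Monomials in the noncommuting variables. -/
abbrev NCWord := FreeMonoid (Letter P m)

variable (P m) in
/-- Polynomials with real coefficients in the noncommuting variables. -/
abbrev NCPoly := MonoidAlgebra ℝ (NCWord P m)

/-- The adjoint of a monomial. -/
def NCWord.adj (u : NCWord P m) : NCWord P m :=
  FreeMonoid.ofList ((FreeMonoid.toList u).map Letter.adj).reverse

/-- A monomial as a polynomial. -/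
def mono (u : NCWord P m) : NCPoly P m := MonoidAlgebra.of ℝ (NCWord P m) u

/-- A variable as a polynomial. -/
def ncVar (l : Letter P m) : NCPoly P m := mono (FreeMonoid.of l)

/-- The equations imposed on the variables. -/
inductive NPARelation (P : Protocol X Y A B C) (m : ℕ) : Type _
  | sumA (x : X)
  | sumB (y : Y)
  | commAB (x : X) (a : P.outA x) (y : Y) (b : P.outB y)
  | commAE (x : X) (a : P.outA x) (x' : P.keyX) (a' : P.outA x'.1) (i : Fin m)
  | commAEadj (x : X) (a : P.outA x) (x' : P.keyX) (a' : P.outA x'.1) (i : Fin m)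
  | commBE (y : Y) (b : P.outB y) (x' : P.keyX) (a' : P.outA x'.1) (i : Fin m)
  | commBEadj (y : Y) (b : P.outB y) (x' : P.keyX) (a' : P.outA x'.1) (i : Fin m)
  | projA (x : X) (a : P.outA x)
  | projB (y : Y) (b : P.outB y)

/-- The commutator of two variables. -/
def ncComm (k l : Letter P m) : NCPoly P m := ncVar k * ncVar l - ncVar l * ncVar k

/-- The polynomial whose vanishing is the given equation: completeness of the measurements,
commutation between the three parties, and projectivity of the measurements. -/
def NPARelation.poly : NPARelation P m → NCPoly P m
  | .sumA x => (∑ a, ncVar (.alice x a)) - 1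
  | .sumB y => (∑ b, ncVar (.bob y b)) - 1
  | .commAB x a y b => ncComm (.alice x a) (.bob y b)
  | .commAE x a x' a' i => ncComm (.alice x a) (.eve x' a' i)
  | .commAEadj x a x' a' i => ncComm (.alice x a) (.eveAdj x' a' i)
  | .commBE y b x' a' i => ncComm (.bob y b) (.eve x' a' i)
  | .commBEadj y b x' a' i => ncComm (.bob y b) (.eveAdj x' a' i)
  | .projA x a => ncVar (.alice x a) * ncVar (.alice x a) - ncVar (.alice x a)
  | .projB y b => ncVar (.bob y b) * ncVar (.bob y b) - ncVar (.bob y b)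

/-- The positivity constraints `q ⪰ 0`: the trivial one `q = 1` (which gives the moment matrix),
positivity of the measurement operators, and each equation as two opposite inequalities. -/
inductive NPAConstraint (P : Protocol X Y A B C) (m : ℕ) : Type _
  | unit
  | posA (x : X) (a : P.outA x)
  | posB (y : Y) (b : P.outB y)
  | eqNonneg (r : NPARelation P m)
  | eqNonpos (r : NPARelation P m)

/-- The polynomial that a constraint requires to be positive. -/
def NPAConstraint.poly : NPAConstraint P m → NCPoly P m
  | .unit => 1
  | .posA x a => ncVar (.alice x a)
  | .posB y b => ncVar (.bob y b)
  | .eqNonneg r => r.poly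
  | .eqNonpos r => - r.poly

/-- The polynomial
`P(Z_1, Z_2, …) = 1 + (sin(πα)/π) ∑ (w_i/t_i) (1 + Z_i + Z_i† + (1-t_i) Z_i† Z_i)`
in the variables attached to `x`, `a`. -/
def evePolyP (α : ℝ) (t w : Fin m → ℝ) (x : P.keyX) (a : P.outA x.1) : NCPoly P m :=
  1 + (Real.sin (α * Real.pi) / Real.pi) • ∑ i, (w i / t i) •
    (1 + ncVar (.eve x a i) + ncVar (.eveAdj x a i) +
      (1 - t i) • (ncVar (.eveAdj x a i) * ncVar (.eve x a i)))

/-- The polynomial `Q(Z_1, Z_2, …) = (sin(πα)/π) ∑ w_i Z_i Z_i†`. -/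
def evePolyQ (α : ℝ) (w : Fin m → ℝ) (x : P.keyX) (a : P.outA x.1) : NCPoly P m :=
  (Real.sin (α * Real.pi) / Real.pi) • ∑ i, w i • (ncVar (.eve x a i) * ncVar (.eveAdj x a i))

variable (P) in
/-- The polynomial for the entropy term:
`∑ x ∈ X_K, P(x | T = 0) ∑ a, (M_{a|x} P(Z) + Q(Z))`. -/
def entropyPoly (α : ℝ) (t w : Fin m → ℝ) : NCPoly P m :=
  ∑ x : P.keyX, P.keyProb x.1 • ∑ a : P.outA x.1,
    (ncVar (.alice x.1 a) * evePolyP α t w x a + evePolyQ α w x a)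

variable (P m) in
open scoped Classical in
/-- The polynomial for the probability of the test datum `c`:
`∑ P(x,y,t) M_{a|x} N_{b|y}` over all `a, b, x, y, t` with `f(a,b,x,y,t) = c`. -/
def testPoly (c : Option C) : NCPoly P m :=
  ∑ x : X, ∑ y : Y, ∑ s : Bool, ∑ a : P.outA x, ∑ b : P.outB y,
    if P.testData a.1 b.1 x y s = c then
      P.inputProb x y s • (ncVar (.alice x a) * ncVar (.bob y b))
    else 0

/-- An NPA relaxation: for every constraint a finite set `index j` of monomials that index the
rows and columns of its (moment or localizing) matrix, where an empty set means that the constraint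
is not used, and a finite set `words` of monomials that contains all monomials which then occur;
it carries one real variable for each of its members. -/
structure NPARelaxation (P : Protocol X Y A B C) (α : ℝ) (t w : Fin m → ℝ) where
  words : Finset (NCWord P m)
  index : NPAConstraint P m → Finset (NCWord P m)
  one_mem : 1 ∈ words
  entry_mem : ∀ j, ∀ u ∈ index j, ∀ v ∈ index j,
    (mono u.adj * j.poly * mono v).coeff.support ⊆ words
  test_mem : ∀ c, (testPoly P m c).coeff.support ⊆ words
  entropy_mem : (entropyPoly P α t w).coeff.support ⊆ words

namespace NPARelaxation

variable {α : ℝ} {t w : Fin m → ℝ} (R : NPARelaxation P α t w)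

/-- The linear function `∑ p_u y_u` of the variables `y` which replaces the polynomial `∑ p_u u`. -/
def lin (p : NCPoly P m) (y : R.words → ℝ) : ℝ := ∑ u : R.words, p.coeff u.1 * y u

/-- The linear function `f_c`. -/
def f (y : R.words → ℝ) (c : Option C) : ℝ := R.lin (testPoly P m c) y

/-- The linear function `g`. -/
def g (y : R.words → ℝ) : ℝ := R.lin (entropyPoly P α t w) y

open scoped Classical in
/-- The matrix `M(y)`: block diagonal, the block of the constraint `q ⪰ 0` having the
entries `∑ s, q_s y_{u† s v}`, for `u`, `v` in the index set of the constraint. -/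
def momentMatrix (y : R.words → ℝ) :
    Matrix (Σ j : NPAConstraint P m, R.index j) (Σ j : NPAConstraint P m, R.index j) ℝ :=
  Matrix.blockDiagonal' fun j : NPAConstraint P m =>
    Matrix.of fun u v : R.index j => R.lin (mono u.1.adj * j.poly * mono v.1) y

/-- The feasible set of the relaxed program. -/
def feasible (SΩ : Set (Option C → ℝ)) : Set ((Option C → ℝ) × (R.words → ℝ)) :=
  {z | z.1 ∈ SΩ ∧ z.2 ⟨1, R.one_mem⟩ = 1 ∧ (R.momentMatrix z.2).PosSemidef}

/-- The objective of the relaxed program. -/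
def objective [Fintype C] (SΩ : Set (Option C → ℝ)) (z : (Option C → ℝ) × (R.words → ℝ)) :
    EReal :=
  ((1 / (α - 1) : ℝ) : EReal) * relEntropy z.1 (R.f z.2) +
    ((qMin SΩ / (1 - α) : ℝ) : EReal) * elogTwo (R.g z.2)

/-- The optimal value of the relaxed program. -/
def value [Fintype C] (SΩ : Set (Option C → ℝ)) : EReal :=
  ⨅ z ∈ R.feasible SΩ, R.objective SΩ z

end NPARelaxation

end NPA

/-- The minimisation of `φ` over `F` is a convex optimization problem. -/
def IsConvexProgram {V : Type*} [AddCommGroup V] [Module ℝ V] (F : Set V) (φ : V → EReal) : Prop :=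
  Convex ℝ F ∧ ∀ u ∈ F, ∀ v ∈ F, ∀ a b : ℝ, 0 < a → 0 < b → a + b = 1 →
    φ (a • u + b • v) ≤ (a : EReal) * φ u + (b : EReal) * φ v

end

/-! Every device and state is turned into a feasible point `(q, y)` with the same `q`, the same test
statistics and no larger an objective. The divergence terms then agree. Since `log` is monotone and
the entropy weight has a definite sign, it remains to show `r ≤ g(y)` for `r = Tr[ρ^α σ^(1-α)]`,
where `ρ` is the key state on `A X E` and `σ = 1 ⊗ ρ_XE`.

The bound on `r` starts from scalars. The power `x^(α-1)` is an integral of `1 / (x + (1 - x) s)`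
against the Jacobi weight. The Radau rule has an error of known sign on this integrand, because its
error polynomial has a simple zero at `1` and double zeros at the other nodes. This gives a rational
upper bound on `l^α μ^(1-α)` (`rpow_mul_rpow_le`). Each rational summand is the minimum of a
quadratic function of a real variable `z`. Evaluating at all pairs of eigenvalues of `ρ` and `σ`,
weighted by the overlaps of the eigenvectors, assembles these minimisers into operators `Z i`
(`IsGaussRadauJacobi.exists_trace_le`).

Compressing `Z i` to the blocks labelled by the classical values `(a, x)` can only decrease the
quadratic terms. They carry the negative factor `sin(απ)`, so the upper bound survives
(`quadratureTrace_keyState_le`). In a block, `ρ` becomes Eve's state conditioned on `a` and `σ`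
becomes her reduced state, so the bound is the expectation of `entropyPoly`.

The relaxation may impose projectivity, so the POVMs of each party are first dilated simultaneously
to projective measurements (`exists_projective_dilation`). Operators of different parties act on
different tensor factors and commute. The variables `y` are the resulting moments, and each block of
`M(y)` is a Gram matrix of a positive operator (`exists_posSemidef_momentMatrix`).

The quadrature exists by the theory of orthogonal polynomials for the weight multiplied by `1 - s`.
Convexity holds because relative entropy is sublinear, `-log` is convex, and `f`, `g`, `M` are
linear in `y`. -/

noncomputable section

set_option linter.unusedSectionVars false

/-! ### Gauss–Radau–Jacobi quadrature: existence, location of the nodes, sign of the weights -/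

section Quadrature

open Polynomial MeasureTheory Set

/-- The weight function of the quadrature. -/
def jacobiWeight (α s : ℝ) : ℝ := s ^ (α - 1) * (1 - s) ^ (1 - α)

lemma jacobiWeight_pos {α s : ℝ} (hs : s ∈ Ioo (0 : ℝ) 1) : 0 < jacobiWeight α s :=
  mul_pos (Real.rpow_pos_of_pos hs.1 _) (Real.rpow_pos_of_pos (by linarith [hs.2]) _)

lemma intervalIntegrable_jacobiWeight {α : ℝ} (hα : α ∈ Ioo (1 : ℝ) 2) :
    IntervalIntegrable (jacobiWeight α) volume 0 1 := by
  have h1 : IntervalIntegrable (fun s : ℝ => s ^ (1 - α)) volume 0 1 :=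
    intervalIntegral.intervalIntegrable_rpow' (by linarith [hα.2])
  have h2 : IntervalIntegrable (fun s : ℝ => (1 - s) ^ (1 - α)) volume 0 1 := by
    simpa using (h1.comp_sub_left 1).symm
  exact h2.continuousOn_mul
    (ContinuousOn.rpow_const continuousOn_id fun x _ => Or.inr (by linarith [hα.1]))

lemma intervalIntegrable_mul_jacobiWeight {α : ℝ} (hα : α ∈ Ioo (1 : ℝ) 2) {h : ℝ → ℝ}
    (hh : ContinuousOn h (Icc 0 1)) :
    IntervalIntegrable (fun s => h s * jacobiWeight α s) volume 0 1 :=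
  (intervalIntegrable_jacobiWeight hα).continuousOn_mul (by rwa [uIcc_of_le zero_le_one])

/-- Integration of polynomials against the weight function. -/
def jacobiFunctional (α : ℝ) (hα : α ∈ Ioo (1 : ℝ) 2) : ℝ[X] →ₗ[ℝ] ℝ where
  toFun p := ∫ s in (0 : ℝ)..1, p.eval s * jacobiWeight α s
  map_add' p q := by
    simp only [eval_add, add_mul]
    exact intervalIntegral.integral_add
      (intervalIntegrable_mul_jacobiWeight hα p.continuous.continuousOn)
      (intervalIntegrable_mul_jacobiWeight hα q.continuous.continuousOn)
  map_smul' c p := by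
    simp only [eval_smul, smul_eq_mul, mul_assoc, RingHom.id_apply]
    exact intervalIntegral.integral_const_mul _ _

/-- A nonzero polynomial has finitely many roots, so the integrand is positive almost everywhere.
This is the positive definiteness behind all orthogonality arguments. -/
lemma jacobiFunctional_pos {α : ℝ} (hα : α ∈ Ioo (1 : ℝ) 2) {p : ℝ[X]} (hp : p ≠ 0)
    (h : ∀ s ∈ Ioo (0 : ℝ) 1, 0 ≤ p.eval s) : 0 < jacobiFunctional α hα p := by
  have hint := intervalIntegrable_mul_jacobiWeight hα (h := fun s => p.eval s)
    p.continuous.continuousOn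
  change 0 < ∫ s in (0 : ℝ)..1, p.eval s * jacobiWeight α s
  rw [intervalIntegral.integral_pos_iff_support_of_nonneg_ae' _ hint]
  · refine ⟨zero_lt_one, ?_⟩
    have hsub : Ioo (0 : ℝ) 1 \ (p.roots.toFinset : Set ℝ) ⊆
        Function.support (fun s => p.eval s * jacobiWeight α s) ∩ Ioc 0 1 := by
      rintro s ⟨hs, hr⟩
      refine ⟨mul_ne_zero ?_ (jacobiWeight_pos hs).ne', Ioo_subset_Ioc_self hs⟩
      simpa [hp] using hr
    refine lt_of_lt_of_le ?_ (measure_mono hsub)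
    rw [measure_sdiff_null (Finset.measure_zero _ _)]
    simp
  · rw [uIoc_of_le zero_le_one, ← restrict_Ioo_eq_restrict_Ioc]
    refine (ae_restrict_iff' measurableSet_Ioo).2 (Filter.Eventually.of_forall fun s hs => ?_)
    exact mul_nonneg (h s hs) (jacobiWeight_pos hs).le

/-- A polynomial of every degree that is orthogonal to all polynomials of smaller degree, for the
weight multiplied by `1 - s`. -/
lemma exists_orthogonal_polynomial {α : ℝ} (hα : α ∈ Ioo (1 : ℝ) 2) (n : ℕ) :
    ∃ p : ℝ[X], p.Monic ∧ p.natDegree = n ∧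
      ∀ r : ℝ[X], r.degree < n → jacobiFunctional α hα ((1 - X) * (p * r)) = 0 := by
  let J : ℝ[X] →ₗ[ℝ] ℝ := jacobiFunctional α hα ∘ₗ LinearMap.mulLeft ℝ (1 - X)
  let V := degreeLT ℝ n
  -- `T` is the Gram map of the form `∫ (1 - s) r q` with the Jacobi weight. It is injective by
  -- positivity, hence onto by dimension, so the functional `q ↦ J (X ^ n * q)` has a representative
  -- `r₀`: the orthogonal projection of `X ^ n`.
  let T : V →ₗ[ℝ] Module.Dual ℝ V :=
    { toFun := fun r => J ∘ₗ LinearMap.mulLeft ℝ r.1 ∘ₗ V.subtype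
      map_add' := fun r s => by ext q; simp [add_mul]
      map_smul' := fun c r => by ext q; simp }
  have hfin : FiniteDimensional ℝ V := Module.Finite.equiv (degreeLTEquiv ℝ n).symm
  have hinj : Function.Injective T := by
    rw [injective_iff_map_eq_zero]
    intro r hr
    by_contra hne
    have hr0 : r.1 ≠ 0 := fun h => hne (Subtype.ext h)
    have h1 : T r r = 0 := by rw [hr]; rfl
    have h2 : 0 < jacobiFunctional α hα ((1 - X) * (r.1 * r.1)) := by
      refine jacobiFunctional_pos hα (mul_ne_zero ?_ (mul_ne_zero hr0 hr0)) fun s hs => ?_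
      · intro h
        have := congrArg (eval 0) h
        simp at this
      · simp only [eval_mul, eval_sub, eval_one, eval_X]
        exact mul_nonneg (by linarith [hs.2]) (mul_self_nonneg _)
    exact h2.ne' h1
  have hsurj : Function.Surjective T :=
    (LinearMap.injective_iff_surjective_of_finrank_eq_finrank
      (Subspace.dual_finrank_eq (K := ℝ) (V := V)).symm).1 hinj
  obtain ⟨r₀, hr₀⟩ := hsurj (J ∘ₗ LinearMap.mulLeft ℝ (X ^ n) ∘ₗ V.subtype)
  have hdeg : r₀.1.degree < n := mem_degreeLT.1 r₀.2
  rw [← degree_X_pow (R := ℝ) n] at hdeg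
  refine ⟨X ^ n - r₀.1, (monic_X_pow n).sub_of_left hdeg, ?_, fun r hr => ?_⟩
  · rw [natDegree_eq_of_degree_eq (degree_sub_eq_left_of_degree_lt hdeg), natDegree_X_pow]
  · have := congrArg (fun L => L ⟨r, mem_degreeLT.2 hr⟩) hr₀
    have h3 : J (r₀.1 * r) = J (X ^ n * r) := this
    have h4 : J ((X ^ n - r₀.1) * r) = 0 := by rw [sub_mul, map_sub, h3, sub_self]
    exact h4

/-- If `g` were nonnegative on `(0, 1)` and `p = g r`, then `r` would have degree below `n`, and
orthogonality to `r` would make the integral of `(1 - s) g r²` vanish. -/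
lemma exists_sign_change_of_dvd {α : ℝ} (hα : α ∈ Ioo (1 : ℝ) 2) {n : ℕ} {p : ℝ[X]}
    (hp : p.Monic) (hn : p.natDegree = n)
    (horth : ∀ r : ℝ[X], r.degree < n → jacobiFunctional α hα ((1 - X) * (p * r)) = 0)
    {g : ℝ[X]} (hg : g ∣ p) (hg1 : 1 ≤ g.natDegree) : ∃ s ∈ Ioo (0 : ℝ) 1, g.eval s < 0 := by
  by_contra! hcon
  obtain ⟨r, rfl⟩ := hg
  have hg0 : g ≠ 0 := by rintro rfl; simp at hg1
  have hr0 : r ≠ 0 := by rintro rfl; simp at hp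
  have hd : r.degree < n := by
    rw [← hn, natDegree_mul hg0 hr0, degree_eq_natDegree hr0]
    exact_mod_cast (by omega : r.natDegree < g.natDegree + r.natDegree)
  refine (jacobiFunctional_pos hα (p := (1 - X) * (g * r * r)) ?_ fun s hs => ?_).ne' (horth r hd)
  · refine mul_ne_zero (fun h => ?_) (mul_ne_zero (mul_ne_zero hg0 hr0) hr0)
    have := congrArg (eval 0) h
    simp at this
  · simp only [eval_mul, eval_sub, eval_one, eval_X, mul_assoc]
    exact mul_nonneg (by linarith [hs.2]) (mul_nonneg (hcon s hs) (mul_self_nonneg _))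

/-- Both `g` and `-g` take a negative value, so the intermediate value theorem applies. -/
lemma exists_root_of_dvd {α : ℝ} (hα : α ∈ Ioo (1 : ℝ) 2) {n : ℕ} {p : ℝ[X]}
    (hp : p.Monic) (hn : p.natDegree = n)
    (horth : ∀ r : ℝ[X], r.degree < n → jacobiFunctional α hα ((1 - X) * (p * r)) = 0)
    {g : ℝ[X]} (hg : g ∣ p) (hg1 : 1 ≤ g.natDegree) : ∃ s ∈ Ioo (0 : ℝ) 1, g.eval s = 0 := by
  obtain ⟨a, ha, hga⟩ := exists_sign_change_of_dvd hα hp hn horth hg hg1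
  obtain ⟨b, hb, hgb⟩ := exists_sign_change_of_dvd hα hp hn horth (g := -g)
    ((neg_dvd).2 hg) (by simpa using hg1)
  rw [eval_neg, neg_lt_zero] at hgb
  obtain ⟨c, hc, hc0⟩ := isPreconnected_Ioo.intermediate_value ha hb
    g.continuous.continuousOn ⟨hga.le, hgb.le⟩
  exact ⟨c, hc, hc0⟩

/-- Each claim tests a suitable divisor of `p`: the root-free cofactor would have a root, a factor
`(X - a)²` would be negative somewhere, and `X - a` must vanish inside `(0, 1)`. -/
lemma orthogonal_polynomial_roots {α : ℝ} (hα : α ∈ Ioo (1 : ℝ) 2) {n : ℕ} {p : ℝ[X]}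
    (hp : p.Monic) (hn : p.natDegree = n)
    (horth : ∀ r : ℝ[X], r.degree < n → jacobiFunctional α hα ((1 - X) * (p * r)) = 0) :
    p.Splits ∧ p.roots.Nodup ∧ ∀ a ∈ p.roots, a ∈ Ioo (0 : ℝ) 1 := by
  refine ⟨?_, ?_, ?_⟩
  · obtain ⟨q, hq, hcard, hq0⟩ := exists_prod_multiset_X_sub_C_mul p
    have hqdeg : q.natDegree = 0 := by
      by_contra h
      obtain ⟨s, -, hs⟩ := exists_root_of_dvd hα hp hn horth (g := q) (Dvd.intro_left _ hq)
        (Nat.one_le_iff_ne_zero.2 h)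
      have hmem : s ∈ q.roots := (mem_roots (by rintro rfl; simp at h)).2 hs
      simp [hq0] at hmem
    exact splits_iff_card_roots.2 (by omega)
  · rw [Multiset.nodup_iff_count_le_one]
    intro a
    rw [count_roots]
    by_contra! h
    obtain ⟨s, -, hs⟩ := exists_sign_change_of_dvd hα hp hn horth (g := (X - C a) ^ 2)
      ((le_rootMultiplicity_iff hp.ne_zero).1 h) (by simp)
    simp only [eval_pow, eval_sub, eval_X, eval_C] at hs
    nlinarith [sq_nonneg (s - a)]
  · intro a ha
    obtain ⟨s, hs, hs0⟩ := exists_root_of_dvd hα hp hn horth (g := X - C a)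
      (dvd_iff_isRoot.2 (isRoot_of_mem_roots ha)) (by simp)
    simp only [eval_sub, eval_X, eval_C] at hs0
    rwa [← sub_eq_zero.1 hs0]

/-- The nodes are `1` and the `n = m - 1` roots of the orthogonal polynomial `p`; the weights
integrate the Lagrange basis. Interpolation gives exactness up to degree `n`. For degree up to `2n`,
division by `p (X - 1)` leaves a quotient of degree below `n`, whose contribution is killed by
orthogonality on the integral side and by the nodes on the sum side. -/
theorem exists_isGaussRadauJacobi {α : ℝ} (hα : α ∈ Ioo (1 : ℝ) 2) {m : ℕ} (hm : 1 ≤ m) :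
    ∃ t w : Fin m → ℝ, IsGaussRadauJacobi α t w := by
  obtain ⟨n, rfl⟩ : ∃ n, m = n + 1 := ⟨m - 1, by omega⟩
  obtain ⟨p, hp, hn, horth⟩ := exists_orthogonal_polynomial hα n
  obtain ⟨hsplit, hnodup, hroots⟩ := orthogonal_polynomial_roots hα hp hn horth
  have h1 : (1 : ℝ) ∉ p.roots.toFinset := fun h =>
    lt_irrefl _ (hroots 1 (Multiset.mem_toFinset.1 h)).2
  let S : Finset ℝ := insert 1 p.roots.toFinset
  have hS : S.card = n + 1 := by
    rw [Finset.card_insert_of_notMem h1, Multiset.toFinset_card_of_nodup hnodup,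
      ← hsplit.natDegree_eq_card_roots, hn]
  have hle : ∀ a ∈ S, a ≤ 1 := by
    intro a ha
    rcases Finset.mem_insert.1 ha with rfl | ha
    · exact le_rfl
    · exact (hroots a (Multiset.mem_toFinset.1 ha)).2.le
  let t : Fin (n + 1) → ℝ := S.orderEmbOfFin hS
  have hmono : StrictMono t := (S.orderEmbOfFin hS).strictMono
  have hinj : InjOn t (Finset.univ : Finset (Fin (n + 1))) := hmono.injective.injOn
  have hmem : ∀ i, t i ∈ S := S.orderEmbOfFin_mem hS
  let w : Fin (n + 1) → ℝ := fun i => jacobiFunctional α hα (Lagrange.basis Finset.univ t i)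
  have hlow : ∀ r : ℝ[X], r.degree < (n + 1 : ℕ) →
      jacobiFunctional α hα r = ∑ i, w i * r.eval (t i) := by
    intro r hr
    conv_lhs => rw [Lagrange.eq_interpolate hinj (f := r) (by simpa using hr),
      Lagrange.interpolate_apply]
    rw [map_sum]
    refine Finset.sum_congr rfl fun i _ => ?_
    rw [← smul_eq_C_mul, map_smul, smul_eq_mul, mul_comm]
  refine ⟨t, w, hmono, fun i hi => ?_, fun q hq => ?_⟩
  · refine le_antisymm (hle _ (hmem i)) ?_
    have : (1 : ℝ) ∈ range t := by
      rw [S.range_orderEmbOfFin hS]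
      simp [S]
    obtain ⟨j, hj⟩ := this
    rw [← hj]
    exact hmono.monotone (Fin.le_def.2 (by omega))
  · change jacobiFunctional α hα q = _
    have hN : (p * (X - C 1)).Monic := hp.mul (monic_X_sub_C 1)
    have hNdeg : (p * (X - C 1)).natDegree = n + 1 := by
      rw [hp.natDegree_mul (monic_X_sub_C 1), hn, natDegree_X_sub_C]
    have hNeval : ∀ i, (p * (X - C 1)).eval (t i) = 0 := by
      intro i
      rcases Finset.mem_insert.1 (hmem i) with h | h
      · simp [h]
      · rw [eval_mul, (isRoot_of_mem_roots (Multiset.mem_toFinset.1 h)).eq_zero, zero_mul]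
    set d := q /ₘ (p * (X - C 1)) with hd
    set r := q %ₘ (p * (X - C 1)) with hr
    have hdiv : r + p * (X - C 1) * d = q := modByMonic_add_div q _
    have hrdeg : r.degree < (n + 1 : ℕ) := by
      rw [← hNdeg, ← degree_eq_natDegree hN.ne_zero]
      exact degree_modByMonic_lt q hN
    have hddeg : d.degree < n := by
      by_cases hd0 : d = 0
      · rw [hd0, degree_zero]; exact WithBot.bot_lt_coe _
      · have h2 := natDegree_divByMonic q hN
        rw [← hd, hNdeg] at h2
        have h3 : n + 1 ≤ q.natDegree := by
          by_contra! h
          refine hd0 ((divByMonic_eq_zero_iff hN).2 ?_)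
          rw [degree_eq_natDegree hN.ne_zero, hNdeg]
          exact lt_of_le_of_lt degree_le_natDegree (by exact_mod_cast h)
        rw [degree_eq_natDegree hd0]
        exact_mod_cast (by omega : d.natDegree < n)
    have h0 := horth d hddeg
    have h5 : p * (X - C 1) * d = -((1 - X) * (p * d)) := by
      simp only [map_one]; ring
    rw [← hdiv, map_add, h5, map_neg, h0, neg_zero, add_zero, hlow r hrdeg]
    refine Finset.sum_congr rfl fun i _ => ?_
    rw [← h5, eval_add, eval_mul, hNeval, zero_mul, add_zero]

namespace IsGaussRadauJacobi

variable {α : ℝ} {m : ℕ} {t w : Fin m → ℝ}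

lemma le_one (h : IsGaussRadauJacobi α t w) (i : Fin m) : t i ≤ 1 := by
  have hi := i.2
  have hlast := h.last_eq_one ⟨m - 1, by omega⟩ (by simp; omega)
  rw [← hlast]
  exact h.strictMono.monotone (Fin.le_def.2 (by simp; omega))

/-- The nonnegative polynomial `∏ (X - t j)²` over `j ≠ i` has degree `2m - 2`, the largest allowed,
and only the `i`-th summand of the rule survives. -/
lemma weight_pos (h : IsGaussRadauJacobi α t w) (hα : α ∈ Ioo (1 : ℝ) 2) (i : Fin m) :
    0 < w i := by
  let p : ℝ[X] := ∏ j ∈ Finset.univ.erase i, (X - C (t j)) ^ 2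
  have hcard : (Finset.univ.erase i).card + 1 = m := by
    rw [Finset.card_erase_of_mem (Finset.mem_univ i), Finset.card_univ, Fintype.card_fin]
    have := i.2; omega
  have hmonic : p.Monic := monic_prod_of_monic _ _ fun j _ => (monic_X_sub_C _).pow 2
  have hdeg : p.natDegree + 2 ≤ 2 * m := by
    rw [natDegree_prod_of_monic _ _ fun j _ => (monic_X_sub_C _).pow 2]
    simp only [natDegree_pow, natDegree_X_sub_C, Finset.sum_const, smul_eq_mul]
    omega
  have hev : ∀ s, p.eval s = ∏ j ∈ Finset.univ.erase i, (s - t j) ^ 2 := fun s => by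
    simp [p, eval_prod]
  have hpos : 0 < jacobiFunctional α hα p := jacobiFunctional_pos hα hmonic.ne_zero fun s _ => by
    rw [hev]; exact Finset.prod_nonneg fun j _ => sq_nonneg _
  have hsum : jacobiFunctional α hα p = ∑ j, w j * p.eval (t j) := h.exact_on p hdeg
  rw [hsum, Finset.sum_eq_single i] at hpos
  · refine pos_of_mul_pos_left hpos ?_
    rw [hev]; exact Finset.prod_nonneg fun j _ => sq_nonneg _
  · intro j _ hj
    rw [hev, Finset.prod_eq_zero (Finset.mem_erase.2 ⟨hj, Finset.mem_univ j⟩) (by simp), mul_zero]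
  · simp

/-- Were `t i ≤ 0`, the polynomial `(X - t i)(X - 1)` times the squares of the remaining node
factors would still have degree `2m - 2`, vanish at all nodes, and be nonpositive on `(0, 1)`; its
integral would be both zero and negative. -/
lemma node_pos (h : IsGaussRadauJacobi α t w) (hα : α ∈ Ioo (1 : ℝ) 2) (i : Fin m) :
    0 < t i := by
  by_contra! hneg
  have hm : 0 < m := Nat.zero_lt_of_lt i.2
  let l : Fin m := ⟨m - 1, by omega⟩
  have hl : t l = 1 := h.last_eq_one l (by simp [l]; omega)
  have hil : i ≠ l := by rintro rfl; rw [hl] at hneg; linarith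
  let s₀ := (Finset.univ.erase i).erase l
  have hcard : s₀.card + 2 = m := by
    rw [Finset.card_erase_of_mem (Finset.mem_erase.2 ⟨hil.symm, Finset.mem_univ l⟩),
      Finset.card_erase_of_mem (Finset.mem_univ i), Finset.card_univ, Fintype.card_fin]
    have h1 := i.2
    have h2 : (i : ℕ) ≠ m - 1 := fun h => hil (Fin.ext h)
    omega
  let q : ℝ[X] := ∏ j ∈ s₀, (X - C (t j)) ^ 2
  have hqm : q.Monic := monic_prod_of_monic _ _ fun j _ => (monic_X_sub_C _).pow 2
  let p : ℝ[X] := (X - C (t i)) * (X - C 1) * q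
  have hpm : p.Monic := ((monic_X_sub_C _).mul (monic_X_sub_C _)).mul hqm
  have hdeg : p.natDegree + 2 ≤ 2 * m := by
    rw [((monic_X_sub_C _).mul (monic_X_sub_C _)).natDegree_mul hqm,
      (monic_X_sub_C _).natDegree_mul (monic_X_sub_C _),
      natDegree_prod_of_monic _ _ fun j _ => (monic_X_sub_C _).pow 2]
    simp only [natDegree_pow, natDegree_X_sub_C, Finset.sum_const, smul_eq_mul]
    omega
  have hev : ∀ s, p.eval s = (s - t i) * (s - 1) * ∏ j ∈ s₀, (s - t j) ^ 2 := fun s => by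
    simp [p, q, eval_prod]
  have hsum : jacobiFunctional α hα p = ∑ j, w j * p.eval (t j) := h.exact_on p hdeg
  have hzero : ∀ j, p.eval (t j) = 0 := by
    intro j
    rw [hev]
    by_cases hji : j = i
    · simp [hji]
    by_cases hjl : j = l
    · simp [hjl, hl]
    · rw [Finset.prod_eq_zero (i := j) (by simp [s₀, hji, hjl]) (by simp), mul_zero]
  have hpos : 0 < jacobiFunctional α hα (-p) :=
    jacobiFunctional_pos hα (neg_ne_zero.2 hpm.ne_zero) fun s hs => by
      rw [eval_neg, hev, ← neg_mul]
      refine mul_nonneg ?_ (Finset.prod_nonneg fun j _ => sq_nonneg _)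
      nlinarith [hs.1, hs.2]
  rw [map_neg, hsum] at hpos
  simp [hzero] at hpos

end IsGaussRadauJacobi

end Quadrature

/-! ### Rational upper bound on products of real powers -/

section ScalarBound

open Polynomial MeasureTheory Set

/-- Substitution `u = s / (1 - s)`. -/
lemma integral_Ioi_eq_integral_Ioo (g : ℝ → ℝ) :
    ∫ u in Ioi (0 : ℝ), g u = ∫ s in Ioo (0 : ℝ) 1, ((1 - s) ^ 2)⁻¹ * g (s / (1 - s)) := by
  have himg : (fun s : ℝ => s / (1 - s)) '' Ioo 0 1 = Ioi 0 := by
    ext u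
    constructor
    · rintro ⟨s, hs, rfl⟩
      exact div_pos hs.1 (by linarith [hs.2])
    · intro hu
      have hu' : 0 < u := hu
      refine ⟨u / (1 + u), ⟨by positivity, ?_⟩, ?_⟩
      · rw [div_lt_one (by positivity)]; linarith
      · field_simp
        ring
  have hderiv : ∀ s ∈ Ioo (0 : ℝ) 1,
      HasDerivWithinAt (fun s : ℝ => s / (1 - s)) (((1 - s) ^ 2)⁻¹) (Ioo 0 1) s := by
    intro s hs
    have h1 : (1 : ℝ) - s ≠ 0 := by linarith [hs.2]
    have := ((hasDerivAt_id s).div ((hasDerivAt_id s).const_sub 1) h1).hasDerivWithinAt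
      (s := Ioo (0 : ℝ) 1)
    convert! this using 1
    simp only [id]
    field_simp
    ring
  have hinj : InjOn (fun s : ℝ => s / (1 - s)) (Ioo 0 1) := by
    intro a ha b hb hab
    have h1 : (1 : ℝ) - a ≠ 0 := by linarith [ha.2]
    have h2 : (1 : ℝ) - b ≠ 0 := by linarith [hb.2]
    simp only [div_eq_div_iff h1 h2] at hab
    linarith
  rw [← himg, integral_image_eq_integral_abs_deriv_smul measurableSet_Ioo hderiv hinj]
  refine setIntegral_congr_fun measurableSet_Ioo fun s _ => ?_
  simp only [smul_eq_mul]
  rw [abs_of_nonneg (by positivity)]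

lemma integral_rpowIntegrand_eq_integral_Ioo {β x : ℝ} (hβ : β ∈ Ioo (0 : ℝ) 1) (hx : 0 < x) :
    ∫ u in Ioi (0 : ℝ), Real.rpowIntegrand₀₁ β u x =
      ∫ s in Ioo (0 : ℝ) 1, s ^ (β - 1) * (1 - s) ^ (-β) * (x / (x + (1 - x) * s)) := by
  rw [integral_Ioi_eq_integral_Ioo]
  refine setIntegral_congr_fun measurableSet_Ioo fun s hs => ?_
  have h1 : 0 < 1 - s := by linarith [hs.2]
  have h0 : 0 < s := hs.1
  rw [Real.rpowIntegrand₀₁_eq_pow_div hβ (by positivity) hx.le, Real.div_rpow h0.le h1.le]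
  have e1 : (1 - s) ^ (-β) = (1 - s)⁻¹ * ((1 - s) ^ (β - 1))⁻¹ := by
    rw [← Real.rpow_neg h1.le, ← Real.rpow_neg_one, ← Real.rpow_add h1]
    congr 1; ring
  have h2 : 0 < x + (1 - x) * s := by nlinarith
  have h3 : s / (1 - s) + x ≠ 0 := by positivity
  have h4 : (1 - s) ^ (β - 1) ≠ 0 := (Real.rpow_pos_of_pos h1 _).ne'
  have e2 : s / (1 - s) + x = (x + (1 - x) * s) / (1 - s) := by field_simp; ring
  rw [e1, e2]
  field_simp

/-- This is the Beta integral at `(β, 1 - β)`, evaluated by the reflection formula for the Gamma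
function. -/
lemma integral_beta_weight {β : ℝ} (hβ : β ∈ Ioo (0 : ℝ) 1) :
    ∫ s in Ioo (0 : ℝ) 1, s ^ (β - 1) * (1 - s) ^ (-β) = Real.pi / Real.sin (Real.pi * β) := by
  have h1 := Complex.Gamma_mul_Gamma_eq_betaIntegral (s := (β : ℂ)) (t := ((1 - β : ℝ) : ℂ))
    (by simpa using hβ.1) (by simpa using hβ.2)
  have h2 : (β : ℂ) + ((1 - β : ℝ) : ℂ) = 1 := by push_cast; ring
  rw [h2, Complex.Gamma_one, one_mul, Complex.Gamma_ofReal, Complex.Gamma_ofReal,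
    ← Complex.ofReal_mul, Real.Gamma_mul_Gamma_one_sub, Complex.betaIntegral,
    intervalIntegral.integral_of_le zero_le_one, integral_Ioc_eq_integral_Ioo] at h1
  have h3 : ∫ s in Ioo (0 : ℝ) 1, (s : ℂ) ^ ((β : ℂ) - 1) * (1 - (s : ℂ)) ^ (((1 - β : ℝ) : ℂ) - 1)
      = ∫ s in Ioo (0 : ℝ) 1, ((s ^ (β - 1) * (1 - s) ^ (-β) : ℝ) : ℂ) := by
    refine setIntegral_congr_fun measurableSet_Ioo fun s hs => ?_
    rw [Complex.ofReal_mul, Complex.ofReal_cpow hs.1.le,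
      Complex.ofReal_cpow (by linarith [hs.2])]
    push_cast
    congr 2
    ring
  rw [h3, integral_complex_ofReal] at h1
  exact_mod_cast h1.symm

/-- A non-integrable function has integral `0` by convention, whereas this integral is positive. -/
lemma integrableOn_beta_weight {β : ℝ} (hβ : β ∈ Ioo (0 : ℝ) 1) :
    IntegrableOn (fun s : ℝ => s ^ (β - 1) * (1 - s) ^ (-β)) (Ioo 0 1) := by
  by_contra h
  have := integral_undef h
  rw [integral_beta_weight hβ] at this
  have hs : 0 < Real.sin (Real.pi * β) :=
    Real.sin_pos_of_pos_of_lt_pi (mul_pos Real.pi_pos hβ.1)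
      (by nlinarith [hβ.2, Real.pi_pos])
  exact (div_pos Real.pi_pos hs).ne' this

lemma sin_mul_pi_neg {α : ℝ} (hα : α ∈ Ioo (1 : ℝ) 2) : Real.sin (α * Real.pi) < 0 := by
  have h : Real.sin (α * Real.pi) = - Real.sin ((α - 1) * Real.pi) := by
    rw [sub_mul, one_mul, Real.sin_sub_pi, neg_neg]
  rw [h, neg_lt_zero]
  exact Real.sin_pos_of_pos_of_lt_pi (mul_pos (by linarith [hα.1]) Real.pi_pos)
    (by nlinarith [hα.2, Real.pi_pos])

lemma add_one_sub_mul_pos {x s : ℝ} (hx : 0 < x) (hs : s ∈ Icc (0 : ℝ) 1) :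
    0 < x + (1 - x) * s := by
  rcases eq_or_lt_of_le hs.2 with h | h
  · rw [h]; linarith
  · nlinarith [hs.1]

/-- The integral representation of real powers with exponents in `(0, 1)`. -/
lemma rpow_sub_one_eq_integral {α x : ℝ} (hα : α ∈ Ioo (1 : ℝ) 2) (hx : 0 < x) :
    x ^ (α - 1) = 1 + Real.sin (α * Real.pi) / Real.pi * ((1 - x) *
      ∫ s in (0 : ℝ)..1, (x + (1 - x) * s)⁻¹ * jacobiWeight α s) := by
  have hβ : α - 1 ∈ Ioo (0 : ℝ) 1 := ⟨by linarith [hα.1], by linarith [hα.2]⟩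
  have hrep := Real.rpow_eq_const_mul_integral hβ hx.le
  rw [integral_rpowIntegrand_eq_integral_Ioo hβ hx,
    integral_rpowIntegrand_eq_integral_Ioo hβ one_pos] at hrep
  have hone : ∫ s in Ioo (0 : ℝ) 1, s ^ (α - 1 - 1) * (1 - s) ^ (-(α - 1)) *
      (1 / (1 + (1 - 1) * s)) = Real.pi / Real.sin (Real.pi * (α - 1)) := by
    rw [← integral_beta_weight hβ]
    refine setIntegral_congr_fun measurableSet_Ioo fun s _ => ?_
    simp
  have hsin : Real.sin (Real.pi * (α - 1)) = - Real.sin (α * Real.pi) := by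
    rw [mul_comm, sub_mul, one_mul, Real.sin_sub_pi]
  have hneg := sin_mul_pi_neg hα
  have hI := intervalIntegrable_mul_jacobiWeight hα (h := fun s => (x + (1 - x) * s)⁻¹) (by
    refine ContinuousOn.inv₀ (by fun_prop) fun s hs => (add_one_sub_mul_pos hx hs).ne')
  rw [intervalIntegrable_iff_integrableOn_Ioo_of_le zero_le_one] at hI
  -- Pointwise, `x / (x + (1 - x) s) = 1 - (1 - x) s / (x + (1 - x) s)`. The extra factor `s` raises
  -- the exponent `α - 2` to `α - 1`, turning the Beta weight into the Jacobi weight.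
  have hsplit : ∫ s in Ioo (0 : ℝ) 1, s ^ (α - 1 - 1) * (1 - s) ^ (-(α - 1)) *
      (x / (x + (1 - x) * s)) =
      Real.pi / Real.sin (Real.pi * (α - 1)) -
        (1 - x) * ∫ s in Ioo (0 : ℝ) 1, (x + (1 - x) * s)⁻¹ * jacobiWeight α s := by
    rw [← integral_beta_weight hβ, ← integral_const_mul,
      ← integral_sub (integrableOn_beta_weight hβ) (hI.const_mul _)]
    refine setIntegral_congr_fun measurableSet_Ioo fun s hs => ?_
    have hpos := add_one_sub_mul_pos hx (Ioo_subset_Icc_self hs)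
    have e1 : s ^ (α - 1) = s ^ (α - 1 - 1) * s := by
      rw [← Real.rpow_add_one hs.1.ne']; congr 1; ring
    have e2 : -(α - 1) = 1 - α := by ring
    simp only [jacobiWeight]
    rw [e1, e2]
    generalize s ^ (α - 1 - 1) = a
    generalize (1 - s) ^ (1 - α) = b
    have hne := hpos.ne'
    generalize hd : x + (1 - x) * s = d at hne
    field_simp
    rw [← hd]
    ring
  rw [hone, hsplit, hsin] at hrep
  rw [hrep, intervalIntegral.integral_of_le zero_le_one, integral_Ioc_eq_integral_Ioo]
  have hpi := Real.pi_pos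
  have hne := hneg.ne
  generalize Real.sin (α * Real.pi) = c at hne
  generalize ∫ s in Ioo (0 : ℝ) 1, (x + (1 - x) * s)⁻¹ * jacobiWeight α s = I
  field_simp
  ring

namespace IsGaussRadauJacobi

variable {α : ℝ} {m : ℕ} {t w : Fin m → ℝ}

/-- The quadrature error for the function `s ↦ 1 / (x + (1 - x) s)` has the sign of `1 - x`. -/
lemma mul_integral_le_mul_sum (h : IsGaussRadauJacobi α t w) (hα : α ∈ Ioo (1 : ℝ) 2)
    (hm : 1 ≤ m) {x : ℝ} (hx : 0 < x) :
    (x - 1) * ∫ s in (0 : ℝ)..1, (x + (1 - x) * s)⁻¹ * jacobiWeight α s ≤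
      (x - 1) * ∑ i, w i * (x + (1 - x) * t i)⁻¹ := by
  rcases eq_or_ne x 1 with rfl | hx1
  · simp
  have hx1' : x - 1 ≠ 0 := sub_ne_zero.2 hx1
  let l : Fin m := ⟨m - 1, by omega⟩
  have hl : t l = 1 := h.last_eq_one l (by simp [l]; omega)
  let q : ℝ[X] := ∏ j ∈ Finset.univ.erase l, (X - C (t j)) ^ 2
  have hqm : q.Monic := monic_prod_of_monic _ _ fun j _ => (monic_X_sub_C _).pow 2
  -- `ω` has degree `2m - 1` and is nonpositive on `[0, 1]`. With `s₀` the pole of the integrand,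
  -- `(1 - ω(s) / ω(s₀)) / (x + (1 - x) s)` is a polynomial of degree at most `2m - 2` agreeing with
  -- the integrand at the nodes. The error integrand is `ω(s) / (ω(s₀) (x + (1 - x) s))`, of
  -- constant sign.
  let ω : ℝ[X] := (X - C 1) * q
  have hcard : (Finset.univ.erase l).card + 1 = m := by
    rw [Finset.card_erase_of_mem (Finset.mem_univ l), Finset.card_univ, Fintype.card_fin]
    omega
  have hωm : ω.Monic := (monic_X_sub_C 1).mul hqm
  have hωdeg : ω.natDegree + 1 = 2 * m := by
    rw [(monic_X_sub_C _).natDegree_mul hqm,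
      natDegree_prod_of_monic _ _ fun j _ => (monic_X_sub_C _).pow 2]
    simp only [natDegree_pow, natDegree_X_sub_C, Finset.sum_const, smul_eq_mul]
    omega
  have hωev : ∀ s, ω.eval s = (s - 1) * ∏ j ∈ Finset.univ.erase l, (s - t j) ^ 2 := fun s => by
    simp [ω, q, eval_prod]
  have hωt : ∀ i, ω.eval (t i) = 0 := by
    intro i
    rw [hωev]
    by_cases hi : i = l
    · simp [hi, hl]
    · rw [Finset.prod_eq_zero (i := i) (by simp [hi]) (by simp), mul_zero]
  set s₀ : ℝ := x / (x - 1) with hs₀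
  have hline : ∀ s, x + (1 - x) * s = (1 - x) * (s - s₀) := fun s => by
    rw [hs₀]; field_simp; ring
  have hnode : ∀ i, 0 < x + (1 - x) * t i := fun i =>
    add_one_sub_mul_pos hx ⟨(h.node_pos hα i).le, h.le_one i⟩
  -- Here `(x - 1)(s₀ - 1) = 1`, and `s₀` is no node because the denominator is positive at every
  -- node.
  have hsign : 0 < (x - 1) * ω.eval s₀ := by
    rw [hωev, ← mul_assoc]
    have e : (x - 1) * (s₀ - 1) = 1 := by rw [hs₀]; field_simp; ring
    rw [e, one_mul]
    refine Finset.prod_pos fun j _ => (sq_pos_of_ne_zero ?_)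
    intro hj
    have := hnode j
    rw [hline, ← neg_sub s₀, hj] at this
    simp at this
  have hω0 : ω.eval s₀ ≠ 0 := fun h0 => by rw [h0] at hsign; simp at hsign
  -- the interpolating polynomial
  let N : ℝ[X] := 1 - C (ω.eval s₀)⁻¹ * ω
  have hNroot : N.eval s₀ = 0 := by simp [N, hω0]
  obtain ⟨r, hr⟩ := dvd_iff_isRoot.2 (show IsRoot N s₀ from hNroot)
  let p : ℝ[X] := C (1 - x)⁻¹ * r
  have h1x : (1 : ℝ) - x ≠ 0 := fun h0 => hx1 (by linarith)
  have hp : ∀ s, 0 < x + (1 - x) * s →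
      p.eval s = (x + (1 - x) * s)⁻¹ * (1 - (ω.eval s₀)⁻¹ * ω.eval s) := by
    intro s hs
    have e := congrArg (eval s) hr
    simp only [N, eval_sub, eval_one, eval_mul, eval_C, eval_X] at e
    rw [e, hline]
    rw [hline] at hs
    have : s - s₀ ≠ 0 := by rintro h0; rw [h0] at hs; simp at hs
    simp only [p, eval_mul, eval_C]
    field_simp
  have hpdeg : p.natDegree + 2 ≤ 2 * m := by
    have hN : N.natDegree ≤ ω.natDegree := by
      refine (natDegree_sub_le _ _).trans ?_
      rw [natDegree_one]
      exact max_le (Nat.zero_le _) (natDegree_C_mul_le _ _)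
    have hrd : r.natDegree + 1 ≤ ω.natDegree ∨ r = 0 := by
      by_cases hr0 : r = 0
      · exact Or.inr hr0
      · left
        rw [hr, natDegree_mul (X_sub_C_ne_zero _) hr0, natDegree_X_sub_C] at hN
        omega
    have hp' : p.natDegree ≤ r.natDegree := natDegree_C_mul_le _ _
    rcases hrd with hrd | hrd
    · omega
    · rw [hrd, natDegree_zero] at hp'
      omega
  have hquad := h.exact_on p hpdeg
  have hsum : ∑ i, w i * p.eval (t i) = ∑ i, w i * (x + (1 - x) * t i)⁻¹ :=
    Finset.sum_congr rfl fun i _ => by rw [hp _ (hnode i), hωt]; simp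
  have hcont : ContinuousOn (fun s : ℝ => (x + (1 - x) * s)⁻¹) (Icc 0 1) :=
    ContinuousOn.inv₀ (by fun_prop) fun s hs => (add_one_sub_mul_pos hx hs).ne'
  have hI1 := intervalIntegrable_mul_jacobiWeight hα hcont
  have hI2 := intervalIntegrable_mul_jacobiWeight hα
    (h := fun s => (x + (1 - x) * s)⁻¹ * ω.eval s) (hcont.mul ω.continuous.continuousOn)
  have hint : ∫ s in (0 : ℝ)..1, p.eval s * (s ^ (α - 1) * (1 - s) ^ (1 - α)) =
      (∫ s in (0 : ℝ)..1, (x + (1 - x) * s)⁻¹ * jacobiWeight α s) - (ω.eval s₀)⁻¹ *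
        ∫ s in (0 : ℝ)..1, ((x + (1 - x) * s)⁻¹ * ω.eval s) * jacobiWeight α s := by
    rw [← intervalIntegral.integral_const_mul,
      ← intervalIntegral.integral_sub hI1 (hI2.const_mul _)]
    refine intervalIntegral.integral_congr fun s hs => ?_
    rw [uIcc_of_le zero_le_one] at hs
    simp only [hp s (add_one_sub_mul_pos hx hs), jacobiWeight]
    ring
  have hnonpos : ∫ s in (0 : ℝ)..1, ((x + (1 - x) * s)⁻¹ * ω.eval s) * jacobiWeight α s ≤ 0 := by
    rw [← neg_nonneg, ← intervalIntegral.integral_neg, intervalIntegral.integral_of_le zero_le_one,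
      integral_Ioc_eq_integral_Ioo]
    refine setIntegral_nonneg measurableSet_Ioo fun s hs => ?_
    have h1 := (add_one_sub_mul_pos hx (Ioo_subset_Icc_self hs)).le
    have h2 : ω.eval s ≤ 0 := by
      rw [hωev]
      exact mul_nonpos_of_nonpos_of_nonneg (by linarith [hs.2])
        (Finset.prod_nonneg fun j _ => sq_nonneg _)
    have h3 := (jacobiWeight_pos (α := α) hs).le
    rw [← neg_mul, ← mul_neg]
    exact mul_nonneg (mul_nonneg (inv_nonneg.2 h1) (neg_nonneg.2 h2)) h3
  rw [hquad, hsum] at hint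
  rw [hint, mul_sub, le_sub_comm, sub_self, ← mul_assoc]
  refine mul_nonpos_of_nonneg_of_nonpos ?_ hnonpos
  have e : (x - 1) * (ω.eval s₀)⁻¹ = (x - 1) * ω.eval s₀ * ((ω.eval s₀)⁻¹) ^ 2 := by
    field_simp
  rw [e]
  positivity

/-- The rational upper bound on `l ^ α * μ ^ (1 - α)` that the quadrature provides. -/
lemma rpow_mul_rpow_le (h : IsGaussRadauJacobi α t w) (hα : α ∈ Ioo (1 : ℝ) 2)
    (hm : 1 ≤ m) {l μ : ℝ} (hl : 0 ≤ l) (hμ : 0 < μ) :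
    l ^ α * μ ^ (1 - α) ≤ l + Real.sin (α * Real.pi) / Real.pi *
      ∑ i, w i * (l * (μ - l) / (l * (1 - t i) + t i * μ)) := by
  rcases eq_or_lt_of_le hl with rfl | hl
  · simp [Real.zero_rpow (by linarith [hα.1] : α ≠ 0)]
  have hx : 0 < l / μ := div_pos hl hμ
  have hneg : Real.sin (α * Real.pi) / Real.pi ≤ 0 :=
    (div_neg_of_neg_of_pos (sin_mul_pi_neg hα) Real.pi_pos).le
  -- The factor `sin(απ)` is negative and reverses the quadrature inequality.
  have hb : (l / μ) ^ (α - 1) ≤ 1 + Real.sin (α * Real.pi) / Real.pi * ((1 - l / μ) *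
      ∑ i, w i * (l / μ + (1 - l / μ) * t i)⁻¹) := by
    rw [rpow_sub_one_eq_integral hα hx]
    have := h.mul_integral_le_mul_sum hα hm hx
    have h2 : (1 - l / μ) * ∑ i, w i * (l / μ + (1 - l / μ) * t i)⁻¹ ≤
        (1 - l / μ) * ∫ s in (0 : ℝ)..1, (l / μ + (1 - l / μ) * s)⁻¹ * jacobiWeight α s := by
      linarith
    linarith [mul_le_mul_of_nonpos_left h2 hneg]
  have e1 : l ^ α * μ ^ (1 - α) = l * (l / μ) ^ (α - 1) := by
    rw [Real.div_rpow hl.le hμ.le, div_eq_mul_inv, ← Real.rpow_neg hμ.le, ← mul_assoc,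
      ← Real.rpow_one_add' hl.le (by linarith [hα.1])]
    congr 2 <;> ring
  rw [e1]
  refine (mul_le_mul_of_nonneg_left hb hl.le).trans_eq ?_
  rw [mul_add, mul_one, mul_left_comm, Finset.mul_sum, Finset.mul_sum]
  congr 2
  refine Finset.sum_congr rfl fun i _ => ?_
  have hpos := add_one_sub_mul_pos hx ⟨(h.node_pos hα i).le, h.le_one i⟩
  have e2 : l / μ + (1 - l / μ) * t i = (l * (1 - t i) + t i * μ) / μ := by field_simp; ring
  rw [e2] at hpos ⊢
  have hd : l * (1 - t i) + t i * μ ≠ 0 := by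
    intro h0; rw [h0] at hpos; simp at hpos
  field_simp

end IsGaussRadauJacobi

end ScalarBound

/-! ### Lifting the scalar bound to pairs of positive matrices -/

section MatrixBound

open Matrix

open scoped MatrixOrder in
lemma Matrix.PosSemidef.exists_eq_conjTranspose_mul_self {n : Type*} [Fintype n]
    {A : Matrix n n ℂ} (hA : A.PosSemidef) : ∃ B : Matrix n n ℂ, A = Bᴴ * B := by
  classical
  obtain ⟨B, hB⟩ := CStarAlgebra.nonneg_iff_eq_star_mul_self.mp hA.nonneg
  exact ⟨B, hB⟩

lemma Matrix.PosSemidef.trace_mul_nonneg {n : Type*} [Fintype n]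
    {A B : Matrix n n ℂ} (hA : A.PosSemidef) (hB : B.PosSemidef) : 0 ≤ (A * B).trace := by
  obtain ⟨C, rfl⟩ := hA.exists_eq_conjTranspose_mul_self
  rw [mul_assoc, trace_mul_comm]
  exact (hB.mul_mul_conjTranspose_same C).trace_nonneg

lemma Matrix.PosSemidef.re_trace_mul_nonneg {n : Type*} [Fintype n]
    {A B : Matrix n n ℂ} (hA : A.PosSemidef) (hB : B.PosSemidef) : 0 ≤ (A * B).trace.re :=
  (Complex.le_def.1 (hA.trace_mul_nonneg hB)).1

variable {n : Type*} [Fintype n] [DecidableEq n]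

/-- A diagonal matrix with real entries. -/
def realDiagonal (a : n → ℝ) : Matrix n n ℂ := diagonal fun i => (a i : ℂ)

lemma re_trace_realDiagonal_mul (a : n → ℝ) (A : Matrix n n ℂ) :
    (realDiagonal a * A).trace.re = ∑ j, a j * (A j j).re := by
  simp [Matrix.trace, realDiagonal]

lemma Matrix.PosSemidef.exists_spectral {ρ : Matrix n n ℂ} (hρ : ρ.PosSemidef) :
    ∃ (U : Matrix n n ℂ) (l : n → ℝ), Uᴴ * U = 1 ∧ U * Uᴴ = 1 ∧ (∀ j, 0 ≤ l j) ∧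
      ρ = U * realDiagonal l * Uᴴ ∧
      ∀ s, matPow ρ s = U * realDiagonal (fun j => l j ^ s) * Uᴴ := by
  refine ⟨hρ.1.eigenvectorUnitary, hρ.1.eigenvalues, ?_, ?_, hρ.eigenvalues_nonneg, ?_, ?_⟩
  · exact Unitary.coe_star_mul_self hρ.1.eigenvectorUnitary
  · exact Unitary.coe_mul_star_self hρ.1.eigenvectorUnitary
  · have := hρ.1.spectral_theorem
    rwa [Unitary.conjStarAlgAut_apply] at this
  · intro s
    rw [matPow, hρ.1.cfc_eq, IsHermitian.cfc, Unitary.conjStarAlgAut_apply]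
    rfl

/-- Traces of functions of two noncommuting matrices become sums over pairs of eigenvalues weighted
by squared overlaps, so scalar inequalities in `(l j, μ k)` can be summed. -/
lemma re_trace_spectral_mul_spectral (U V : Matrix n n ℂ) (a b : n → ℝ) :
    (U * realDiagonal a * Uᴴ * (V * realDiagonal b * Vᴴ)).trace.re =
      ∑ j, ∑ k, a j * b k * Complex.normSq ((Uᴴ * V) j k) := by
  have e : (U * realDiagonal a * Uᴴ * (V * realDiagonal b * Vᴴ)).trace =
      (realDiagonal a * ((Uᴴ * V) * realDiagonal b * (Uᴴ * V)ᴴ)).trace := by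
    rw [conjTranspose_mul, conjTranspose_conjTranspose]
    simp only [mul_assoc]
    rw [trace_mul_comm U]
    simp only [mul_assoc]
  rw [e, re_trace_realDiagonal_mul]
  refine Finset.sum_congr rfl fun j _ => ?_
  generalize Uᴴ * V = W
  rw [Matrix.mul_apply, Complex.re_sum, Finset.mul_sum]
  refine Finset.sum_congr rfl fun k _ => ?_
  rw [realDiagonal, Matrix.mul_diagonal, conjTranspose_apply]
  simp only [Complex.star_def, Complex.mul_re, Complex.mul_im, Complex.conj_re, Complex.conj_im,
    Complex.ofReal_re, Complex.ofReal_im, Complex.normSq_apply]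
  ring

/-- The `k`-th eigenvector of the second matrix lies in both kernels, and `l j * (Uᴴ * V) j k` is a
coordinate of the first matrix applied to it. Pairs with `μ k = 0`, where the scalar bound is
unavailable, thus carry no weight. -/
lemma spectral_ker {U V : Matrix n n ℂ} (hU : Uᴴ * U = 1) (hV : Vᴴ * V = 1) {l μ : n → ℝ}
    (hker : ∀ v, (V * realDiagonal μ * Vᴴ) *ᵥ v = 0 → (U * realDiagonal l * Uᴴ) *ᵥ v = 0)
    {j k : n} (hk : μ k = 0) : l j * Complex.normSq ((Uᴴ * V) j k) = 0 := by
  have h1 : (V * realDiagonal μ * Vᴴ) *ᵥ (V *ᵥ Pi.single k 1) = 0 := by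
    rw [mulVec_mulVec, mul_assoc, hV, mul_one, ← mulVec_mulVec, realDiagonal]
    have : (diagonal fun i => (μ i : ℂ)) *ᵥ Pi.single k 1 = 0 := by
      ext i
      by_cases hik : i = k
      · subst hik; simp [mulVec_diagonal, hk]
      · simp [mulVec_diagonal, hik]
    rw [this, mulVec_zero]
  have h2 := hker _ h1
  have h3 : Uᴴ *ᵥ ((U * realDiagonal l * Uᴴ) *ᵥ (V *ᵥ Pi.single k 1)) = 0 := by
    rw [h2, mulVec_zero]
  rw [mulVec_mulVec, mulVec_mulVec, ← mul_assoc, ← mul_assoc, hU, one_mul, mul_assoc] at h3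
  have h4 := congrFun h3 j
  rw [mulVec_single_one, realDiagonal, col_apply, diagonal_mul, Pi.zero_apply] at h4
  rcases mul_eq_zero.1 h4 with h | h
  · rw [Complex.ofReal_eq_zero.1 h, zero_mul]
  · rw [h, map_zero, mul_zero]

/-- The traces of the second moments of the operator with matrix elements
`z j k * conj ((Uᴴ * V) j k)` between two eigenbases. -/
lemma re_trace_overlap {U V : Matrix n n ℂ} (hU : Uᴴ * U = 1) (hV : Vᴴ * V = 1)
    (l μ : n → ℝ) (z : n → n → ℝ) :
    let Z : Matrix n n ℂ := V * (of fun k j => (z j k : ℂ) * star ((Uᴴ * V) j k)) * Uᴴ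
    ((U * realDiagonal l * Uᴴ * Z).trace.re =
        ∑ j, ∑ k, l j * z j k * Complex.normSq ((Uᴴ * V) j k)) ∧
      ((U * realDiagonal l * Uᴴ * Zᴴ).trace.re =
        ∑ j, ∑ k, l j * z j k * Complex.normSq ((Uᴴ * V) j k)) ∧
      ((U * realDiagonal l * Uᴴ * (Zᴴ * Z)).trace.re =
        ∑ j, ∑ k, l j * z j k ^ 2 * Complex.normSq ((Uᴴ * V) j k)) ∧
      ((V * realDiagonal μ * Vᴴ * (Z * Zᴴ)).trace.re =
        ∑ j, ∑ k, μ k * z j k ^ 2 * Complex.normSq ((Uᴴ * V) j k)) := by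
  intro Z
  set K : Matrix n n ℂ := of fun k j => (z j k : ℂ) * star ((Uᴴ * V) j k) with hK
  have hZ : Z = V * K * Uᴴ := rfl
  have hZH : Zᴴ = U * Kᴴ * Vᴴ := by
    rw [hZ, conjTranspose_mul, conjTranspose_mul, conjTranspose_conjTranspose, mul_assoc]
  have h1 : (U * realDiagonal l * Uᴴ * Z).trace.re =
      ∑ j, ∑ k, l j * z j k * Complex.normSq ((Uᴴ * V) j k) := by
    have e : (U * realDiagonal l * Uᴴ * Z).trace = (realDiagonal l * ((Uᴴ * V) * K)).trace := by
      rw [hZ]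
      simp only [mul_assoc]
      rw [trace_mul_comm U]
      simp only [mul_assoc, hU, mul_one]
    rw [e, re_trace_realDiagonal_mul]
    refine Finset.sum_congr rfl fun j _ => ?_
    rw [Matrix.mul_apply, Complex.re_sum, Finset.mul_sum]
    refine Finset.sum_congr rfl fun k _ => ?_
    rw [hK, of_apply]
    simp only [Complex.star_def, Complex.mul_re, Complex.mul_im, Complex.conj_re, Complex.conj_im,
      Complex.ofReal_re, Complex.ofReal_im, Complex.normSq_apply]
    ring
  refine ⟨h1, ?_, ?_, ?_⟩
  · rw [← h1]
    have hD : (U * realDiagonal l * Uᴴ)ᴴ = U * realDiagonal l * Uᴴ := by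
      rw [conjTranspose_mul, conjTranspose_mul, conjTranspose_conjTranspose, realDiagonal,
        diagonal_conjTranspose, mul_assoc]
      congr 3
      ext i
      simp
    have e : (U * realDiagonal l * Uᴴ * Zᴴ).trace = star (U * realDiagonal l * Uᴴ * Z).trace := by
      rw [← trace_conjTranspose, conjTranspose_mul (U * realDiagonal l * Uᴴ) Z, hD, trace_mul_comm]
    rw [e, Complex.star_def, Complex.conj_re]
  · have e : (U * realDiagonal l * Uᴴ * (Zᴴ * Z)).trace = (realDiagonal l * (Kᴴ * K)).trace := by
      have e' : U * realDiagonal l * Uᴴ * (U * Kᴴ * Vᴴ * (V * K * Uᴴ)) =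
          U * (realDiagonal l * (Uᴴ * U) * (Kᴴ * (Vᴴ * V) * K) * Uᴴ) := by
        simp only [mul_assoc]
      rw [hZH, hZ, e', hU, hV, trace_mul_comm, mul_one, mul_one, mul_assoc, hU, mul_one]
    rw [e, re_trace_realDiagonal_mul]
    refine Finset.sum_congr rfl fun j _ => ?_
    rw [Matrix.mul_apply, Complex.re_sum, Finset.mul_sum]
    refine Finset.sum_congr rfl fun k _ => ?_
    rw [conjTranspose_apply, hK, of_apply]
    simp only [Complex.star_def, Complex.mul_re, Complex.mul_im, Complex.conj_re, Complex.conj_im,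
      Complex.ofReal_re, Complex.ofReal_im, Complex.normSq_apply, map_mul]
    ring
  · have e : (V * realDiagonal μ * Vᴴ * (Z * Zᴴ)).trace = (realDiagonal μ * (K * Kᴴ)).trace := by
      have e' : V * realDiagonal μ * Vᴴ * (V * K * Uᴴ * (U * Kᴴ * Vᴴ)) =
          V * (realDiagonal μ * (Vᴴ * V) * (K * (Uᴴ * U) * Kᴴ) * Vᴴ) := by
        simp only [mul_assoc]
      rw [hZH, hZ, e', hU, hV, trace_mul_comm, mul_one, mul_one, mul_assoc, hV, mul_one]
    rw [e, re_trace_realDiagonal_mul, Finset.sum_comm]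
    refine Finset.sum_congr rfl fun k _ => ?_
    rw [Matrix.mul_apply, Complex.re_sum, Finset.mul_sum]
    refine Finset.sum_congr rfl fun j _ => ?_
    rw [conjTranspose_apply, hK, of_apply]
    simp only [Complex.star_def, Complex.mul_re, Complex.mul_im, Complex.conj_re, Complex.conj_im,
      Complex.ofReal_re, Complex.ofReal_im, Complex.normSq_apply, map_mul]
    ring

lemma sum_normSq_overlap {U V : Matrix n n ℂ} (hU : Uᴴ * U = 1) (hV : V * Vᴴ = 1) (j : n) :
    ∑ k, Complex.normSq ((Uᴴ * V) j k) = 1 := by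
  have e : (Uᴴ * V) * (Uᴴ * V)ᴴ = 1 := by
    rw [conjTranspose_mul, conjTranspose_conjTranspose, mul_assoc, ← mul_assoc V, hV, one_mul, hU]
  have e1 := congrArg Complex.re (congrFun (congrFun e j) j)
  rw [Matrix.mul_apply, Complex.re_sum, one_apply_eq, Complex.one_re] at e1
  rw [← e1]
  refine Finset.sum_congr rfl fun k _ => ?_
  rw [conjTranspose_apply, Complex.star_def, Complex.mul_conj, Complex.ofReal_re]

/-- Rows of the overlap matrix have norm one, so a plain trace can be written over the same pairs as
the mixed ones. -/
lemma re_trace_spectral {U V : Matrix n n ℂ} (hU : Uᴴ * U = 1) (hV : V * Vᴴ = 1) (l : n → ℝ) :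
    (U * realDiagonal l * Uᴴ).trace.re = ∑ j, ∑ k, l j * Complex.normSq ((Uᴴ * V) j k) := by
  rw [mul_assoc, trace_mul_comm, mul_assoc, hU, re_trace_realDiagonal_mul]
  refine Finset.sum_congr rfl fun j _ => ?_
  rw [← Finset.mul_sum, sum_normSq_overlap hU hV, one_apply_eq, Complex.one_re]

/-- The trace quantity of the Petz-Rényi divergence of a nonzero state is positive. -/
lemma re_trace_matPow_mul_matPow_pos {ρ σ : Matrix n n ℂ} (hρ : ρ.PosSemidef)
    (hσ : σ.PosSemidef) (hker : ∀ v, σ *ᵥ v = 0 → ρ *ᵥ v = 0) (htr : 0 < ρ.trace.re) (α : ℝ) :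
    0 < (matPow ρ α * matPow σ (1 - α)).trace.re := by
  obtain ⟨U, l, hU, -, hl, rfl, hUp⟩ := hρ.exists_spectral
  obtain ⟨V, μ, hV, hV', hμ, rfl, hVp⟩ := hσ.exists_spectral
  rw [hUp, hVp, re_trace_spectral_mul_spectral]
  rw [re_trace_spectral hU hV'] at htr
  have hnn : ∀ j k, 0 ≤ l j ^ α * μ k ^ (1 - α) * Complex.normSq ((Uᴴ * V) j k) := fun j k =>
    mul_nonneg (mul_nonneg (Real.rpow_nonneg (hl j) _) (Real.rpow_nonneg (hμ k) _))
      (Complex.normSq_nonneg _)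
  obtain ⟨j, -, hj⟩ := Finset.exists_lt_of_sum_lt (f := fun _ : n => (0 : ℝ)) (by simpa using htr)
  obtain ⟨k, -, hk⟩ := Finset.exists_lt_of_sum_lt (f := fun _ : n => (0 : ℝ)) (by simpa using hj)
  refine Finset.sum_pos' (fun j _ => Finset.sum_nonneg fun k _ => hnn j k)
    ⟨j, Finset.mem_univ j, Finset.sum_pos' (fun k _ => hnn j k) ⟨k, Finset.mem_univ k, ?_⟩⟩
  have hlj : 0 < l j := lt_of_le_of_ne (hl j) fun h => by simp [← h] at hk
  -- The kernel inclusion excludes `μ k = 0` for a pair with nonzero weight.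
  have hμk : 0 < μ k := lt_of_le_of_ne (hμ k) fun h => hk.ne' (spectral_ker hU hV hker h.symm)
  have hN : 0 < Complex.normSq ((Uᴴ * V) j k) := pos_of_mul_pos_right hk hlj.le
  exact mul_pos (mul_pos (Real.rpow_pos_of_pos hlj _) (Real.rpow_pos_of_pos hμk _)) hN

/-- The optimal operators in the variational bound on the trace quantity of the Petz-Rényi
divergence that the quadrature provides. -/
theorem IsGaussRadauJacobi.exists_trace_le {α : ℝ} {m : ℕ} {t w : Fin m → ℝ}
    (h : IsGaussRadauJacobi α t w) (hα : α ∈ Set.Ioo (1 : ℝ) 2) (hm : 1 ≤ m)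
    {ρ σ : Matrix n n ℂ} (hρ : ρ.PosSemidef) (hσ : σ.PosSemidef)
    (hker : ∀ v, σ *ᵥ v = 0 → ρ *ᵥ v = 0) :
    ∃ Z : Fin m → Matrix n n ℂ, (matPow ρ α * matPow σ (1 - α)).trace.re ≤
      ρ.trace.re + Real.sin (α * Real.pi) / Real.pi * ∑ i,
        (w i / t i * (ρ.trace.re + (ρ * Z i).trace.re + (ρ * (Z i)ᴴ).trace.re +
            (1 - t i) * (ρ * ((Z i)ᴴ * Z i)).trace.re) +
          w i * (σ * (Z i * (Z i)ᴴ)).trace.re) := by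
  obtain ⟨U, l, hU, -, hl, rfl, hUp⟩ := hρ.exists_spectral
  obtain ⟨V, μ, hV, hV', hμ, rfl, hVp⟩ := hσ.exists_spectral
  rw [hUp, hVp, re_trace_spectral_mul_spectral]
  -- This is the minimiser of `l (1 + 2z + (1 - t) z²) / t + μ z²`; the minimum is `l (μ - l) / (l
  -- (1 - t) + t μ)`, exactly the summand of `rpow_mul_rpow_le`.
  let z : Fin m → n → n → ℝ := fun i j k => -(l j / (l j * (1 - t i) + t i * μ k))
  refine ⟨fun i => V * (of fun k j => (z i j k : ℂ) * star ((Uᴴ * V) j k)) * Uᴴ, ?_⟩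
  have hZ := fun i => re_trace_overlap hU hV l μ (z i)
  simp only at hZ
  simp only [fun i => (hZ i).1, fun i => (hZ i).2.1, fun i => (hZ i).2.2.1,
    fun i => (hZ i).2.2.2, re_trace_spectral hU hV']
  generalize hNdef : (fun j k => Complex.normSq ((Uᴴ * V) j k)) = N
  have hNapp : ∀ j k, Complex.normSq ((Uᴴ * V) j k) = N j k := fun j k => by rw [← hNdef]
  have hkerN : ∀ j k, μ k = 0 → l j * N j k = 0 := fun j k hk => by
    rw [← hNapp]; exact spectral_ker hU hV hker hk
  have hN0 : ∀ j k, 0 ≤ N j k := fun j k => by rw [← hNapp]; exact Complex.normSq_nonneg _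
  simp only [hNapp]
  have hrhs : ∀ c : ℝ, (∑ j, ∑ k, l j * N j k) + c * ∑ i,
        (w i / t i * ((∑ j, ∑ k, l j * N j k) + (∑ j, ∑ k, l j * z i j k * N j k) +
          (∑ j, ∑ k, l j * z i j k * N j k) +
            (1 - t i) * ∑ j, ∑ k, l j * z i j k ^ 2 * N j k) +
          w i * ∑ j, ∑ k, μ k * z i j k ^ 2 * N j k) =
      ∑ j, ∑ k, (l j + c * ∑ i, w i * ((l j + l j * z i j k + l j * z i j k +
          (1 - t i) * (l j * z i j k ^ 2)) / t i + μ k * z i j k ^ 2)) * N j k := by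
    intro c
    simp only [add_mul, Finset.sum_add_distrib, Finset.mul_sum, Finset.sum_mul, mul_add]
    congr 1
    simp only [← Finset.sum_add_distrib]
    rw [Finset.sum_comm]
    refine Finset.sum_congr rfl fun j _ => ?_
    rw [Finset.sum_comm]
    refine Finset.sum_congr rfl fun k _ => Finset.sum_congr rfl fun i _ => ?_
    ring
  rw [hrhs]
  refine Finset.sum_le_sum fun j _ => Finset.sum_le_sum fun k _ => ?_
  rcases eq_or_lt_of_le (hμ k) with hk | hk
  -- For `μ k = 0`, either `l j = 0`, and then `z = 0` through `0 / 0 = 0` and both sides vanish, or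
  -- the weight is zero.
  · rcases mul_eq_zero.1 (hkerN j k hk.symm) with h0 | h0
    · simp [z, h0, ← hk, Real.zero_rpow (by linarith [hα.1] : α ≠ 0)]
    · simp [h0]
  · refine mul_le_mul_of_nonneg_right ?_ (hN0 j k)
    refine (h.rpow_mul_rpow_le hα hm (hl j) hk).trans_eq ?_
    congr 2
    refine Finset.sum_congr rfl fun i _ => ?_
    congr 1
    have ht := h.node_pos hα i
    have hd : l j * (1 - t i) + t i * μ k ≠ 0 := by
      have h1 := mul_nonneg (hl j) (sub_nonneg.2 (h.le_one i))
      have h2 := mul_pos ht hk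
      exact (by linarith : 0 < l j * (1 - t i) + t i * μ k).ne'
    simp only [z]
    generalize hdd : l j * (1 - t i) + t i * μ k = d at hd
    have hμe : μ k = (d - l j * (1 - t i)) / t i := by
      rw [← hdd]; field_simp; ring
    rw [hμe]
    field_simp
    ring

end MatrixBound

/-! ### Partial trace over the measured systems -/

section PartialTrace

open Matrix

lemma kronecker_finsetSum {l m n p ι : Type*} (s : Finset ι) (A : Matrix l m ℂ)
    (B : ι → Matrix n p ℂ) : A ⊗ₖ (∑ i ∈ s, B i) = ∑ i ∈ s, A ⊗ₖ B i := by
  ext; simp [Matrix.sum_apply, Finset.mul_sum]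

lemma finsetSum_kronecker {l m n p ι : Type*} (s : Finset ι) (A : ι → Matrix l m ℂ)
    (B : Matrix n p ℂ) : (∑ i ∈ s, A i) ⊗ₖ B = ∑ i ∈ s, A i ⊗ₖ B := by
  ext; simp [Matrix.sum_apply, Finset.sum_mul]

variable {dA dB dE : ℕ}

/-- The partial trace over `Q_A Q_B` as a linear map. -/
def traceOutABₗ : Matrix (Fin dA × Fin dB × Fin dE) (Fin dA × Fin dB × Fin dE) ℂ →ₗ[ℂ]
    Matrix (Fin dE) (Fin dE) ℂ where
  toFun := traceOutAB
  map_add' σ τ := by ext; simp [traceOutAB, Finset.sum_add_distrib]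
  map_smul' c σ := by ext; simp [traceOutAB, Finset.mul_sum]

/-- This duality characterises the partial trace and reduces identities for it to identities of full
traces. -/
lemma trace_one_kronecker_mul (C : Matrix (Fin dE) (Fin dE) ℂ)
    (τ : Matrix (Fin dA × Fin dB × Fin dE) (Fin dA × Fin dB × Fin dE) ℂ) :
    (((1 : Matrix (Fin dA) (Fin dA) ℂ) ⊗ₖ ((1 : Matrix (Fin dB) (Fin dB) ℂ) ⊗ₖ C)) * τ).trace =
      (traceOutAB τ * C).trace := by
  rw [trace_mul_comm (traceOutAB τ)]
  simp only [Matrix.trace, Matrix.diag, Matrix.mul_apply, Fintype.sum_prod_type, kronecker_apply,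
    one_apply, traceOutAB, ite_mul, one_mul, zero_mul, Finset.sum_ite_eq, Finset.mem_univ, if_true,
    Finset.sum_const_zero, Finset.mul_sum, Finset.sum_ite_irrel]
  refine (Finset.sum_congr rfl fun _ _ => Finset.sum_comm).trans ?_
  rw [Finset.sum_comm]
  refine Finset.sum_congr rfl fun e _ => ?_
  exact (Finset.sum_congr rfl fun _ _ => Finset.sum_comm).trans Finset.sum_comm

lemma trace_traceOutAB
    (τ : Matrix (Fin dA × Fin dB × Fin dE) (Fin dA × Fin dB × Fin dE) ℂ) :
    (traceOutAB τ).trace = τ.trace := by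
  have := trace_one_kronecker_mul 1 τ
  rwa [mul_one, one_kronecker_one, one_kronecker_one, one_mul, eq_comm] at this

lemma trace_traceOutAB_mul (A : Matrix (Fin dA) (Fin dA) ℂ) (B : Matrix (Fin dB) (Fin dB) ℂ)
    (C : Matrix (Fin dE) (Fin dE) ℂ)
    (σ : Matrix (Fin dA × Fin dB × Fin dE) (Fin dA × Fin dB × Fin dE) ℂ) :
    (traceOutAB ((A ⊗ₖ (B ⊗ₖ (1 : Matrix (Fin dE) (Fin dE) ℂ))) * σ) * C).trace =
      ((A ⊗ₖ (B ⊗ₖ C)) * σ).trace := by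
  rw [← trace_one_kronecker_mul, ← mul_assoc, ← mul_kronecker_mul, ← mul_kronecker_mul, one_mul,
    one_mul, mul_one]

/-- Tested against an arbitrary `C`, the operator `1 ⊗ 1 ⊗ C` commutes with `A ⊗ B ⊗ 1`, so
cyclicity of the full trace applies. -/
lemma traceOutAB_mul_comm (A : Matrix (Fin dA) (Fin dA) ℂ) (B : Matrix (Fin dB) (Fin dB) ℂ)
    (σ : Matrix (Fin dA × Fin dB × Fin dE) (Fin dA × Fin dB × Fin dE) ℂ) :
    traceOutAB ((A ⊗ₖ (B ⊗ₖ (1 : Matrix (Fin dE) (Fin dE) ℂ))) * σ) =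
      traceOutAB (σ * (A ⊗ₖ (B ⊗ₖ (1 : Matrix (Fin dE) (Fin dE) ℂ)))) := by
  refine Matrix.ext_iff_trace_mul_right.2 fun C => ?_
  rw [← trace_one_kronecker_mul, ← trace_one_kronecker_mul, ← mul_assoc, ← mul_assoc,
    trace_mul_comm (_ * σ), ← mul_assoc, ← mul_kronecker_mul, ← mul_kronecker_mul,
    ← mul_kronecker_mul, ← mul_kronecker_mul]
  simp only [one_mul, mul_one]

lemma Matrix.PosSemidef.traceOutAB
    {τ : Matrix (Fin dA × Fin dB × Fin dE) (Fin dA × Fin dB × Fin dE) ℂ} (hτ : τ.PosSemidef) :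
    (traceOutAB τ).PosSemidef := by
  have : _root_.traceOutAB τ =
      ∑ i, ∑ j, τ.submatrix (fun e => (i, j, e)) (fun e => (i, j, e)) := by
    ext; simp [_root_.traceOutAB, Matrix.sum_apply]
  rw [this]
  exact posSemidef_sum _ fun i _ => posSemidef_sum _ fun j _ => hτ.submatrix _

/-- Writing the effects as squares and cycling one factor around `σ` exhibits the partial trace of a
positive matrix. -/
lemma posSemidef_traceOutAB_mul {A : Matrix (Fin dA) (Fin dA) ℂ} {B : Matrix (Fin dB) (Fin dB) ℂ}
    {σ : Matrix (Fin dA × Fin dB × Fin dE) (Fin dA × Fin dB × Fin dE) ℂ}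
    (hA : A.PosSemidef) (hB : B.PosSemidef) (hσ : σ.PosSemidef) :
    (traceOutAB ((A ⊗ₖ (B ⊗ₖ (1 : Matrix (Fin dE) (Fin dE) ℂ))) * σ)).PosSemidef := by
  obtain ⟨a, rfl⟩ := hA.exists_eq_conjTranspose_mul_self
  obtain ⟨b, rfl⟩ := hB.exists_eq_conjTranspose_mul_self
  have e : (aᴴ * a) ⊗ₖ ((bᴴ * b) ⊗ₖ (1 : Matrix (Fin dE) (Fin dE) ℂ)) =
      (aᴴ ⊗ₖ (bᴴ ⊗ₖ (1 : Matrix (Fin dE) (Fin dE) ℂ))) *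
        (a ⊗ₖ (b ⊗ₖ (1 : Matrix (Fin dE) (Fin dE) ℂ))) := by
    rw [← mul_kronecker_mul, ← mul_kronecker_mul, one_mul]
  have e2 : aᴴ ⊗ₖ (bᴴ ⊗ₖ (1 : Matrix (Fin dE) (Fin dE) ℂ)) =
      (a ⊗ₖ (b ⊗ₖ (1 : Matrix (Fin dE) (Fin dE) ℂ)))ᴴ := by
    rw [conjTranspose_kronecker, conjTranspose_kronecker, conjTranspose_one]
  rw [e, mul_assoc, traceOutAB_mul_comm, e2]
  exact (hσ.mul_mul_conjTranspose_same _).traceOutAB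

end PartialTrace

/-! ### Conditional states of the environment and input distributions -/

section Device

open Matrix

namespace Protocol

variable {X Y A B C : Type*} [Fintype X] [Fintype Y] {P : Protocol X Y A B C} {dA dB dE : ℕ}

/-- The unnormalised state of the environment when Alice obtains `a` on input `x`. -/
def aliceState (𝒟 : P.Device dA dB) (σ : NormalizedState dA dB dE) (x : X) (a : P.outA x) :
    Matrix (Fin dE) (Fin dE) ℂ :=
  traceOutAB ((𝒟.M x a ⊗ₖ ((1 : Matrix (Fin dB) (Fin dB) ℂ) ⊗ₖ
    (1 : Matrix (Fin dE) (Fin dE) ℂ))) * σ.1)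

lemma posSemidef_aliceState (𝒟 : P.Device dA dB) (σ : NormalizedState dA dB dE) (x : X)
    (a : P.outA x) : (aliceState 𝒟 σ x a).PosSemidef :=
  posSemidef_traceOutAB_mul (𝒟.M_pos x a) PosSemidef.one σ.2.1

lemma sum_aliceState (𝒟 : P.Device dA dB) (σ : NormalizedState dA dB dE) (x : X) :
    ∑ a, aliceState 𝒟 σ x a = traceOutAB σ.1 := by
  have : ∑ a, aliceState 𝒟 σ x a = traceOutABₗ (∑ a, (𝒟.M x a ⊗ₖ ((1 : Matrix (Fin dB) (Fin dB) ℂ)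
      ⊗ₖ (1 : Matrix (Fin dE) (Fin dE) ℂ))) * σ.1) := (map_sum traceOutABₗ _ _).symm
  rw [this, ← Finset.sum_mul, ← finsetSum_kronecker, 𝒟.M_sum, one_kronecker_one,
    one_kronecker_one, one_mul]
  rfl

/-- No-signalling: completeness of Bob's measurement removes his input. -/
lemma sum_traceOutAB (𝒟 : P.Device dA dB) (σ : NormalizedState dA dB dE) (x : X) (a : P.outA x)
    (y : Y) : ∑ b, traceOutAB ((𝒟.M x a ⊗ₖ (𝒟.N y b ⊗ₖ (1 : Matrix (Fin dE) (Fin dE) ℂ))) * σ.1) =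
      aliceState 𝒟 σ x a := by
  refine (map_sum traceOutABₗ _ _).symm.trans ?_
  rw [← Finset.sum_mul, ← kronecker_finsetSum, ← finsetSum_kronecker, 𝒟.N_sum]
  rfl

lemma sum_inputProb (P : Protocol X Y A B C) : ∑ x, ∑ y, ∑ t, P.inputProb x y t = 1 := by
  have h1 := P.keyDist_mem.2
  have h2 := P.testDist_mem.2
  rw [Fintype.sum_prod_type] at h1 h2
  simp only [inputProb, Fintype.sum_bool, if_true, Bool.false_eq_true, if_false,
    Finset.sum_add_distrib, ← Finset.mul_sum, h1, h2]
  ring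

lemma sum_keyProb (P : Protocol X Y A B C) : ∑ x, P.keyProb x = 1 := by
  have h1 := P.keyDist_mem.2
  rwa [Fintype.sum_prod_type] at h1

lemma keyProb_nonneg (P : Protocol X Y A B C) (x : X) : 0 ≤ P.keyProb x :=
  Finset.sum_nonneg fun _ _ => P.keyDist_mem.1 _

lemma keyProb_eq_zero (P : Protocol X Y A B C) {x : X} (hx : x ∉ P.keyX) : P.keyProb x = 0 :=
  Finset.sum_eq_zero fun y _ => by
    by_contra h
    exact hx (P.keyDist_support x y h).1

end Protocol

end Device

/-! ### Block-diagonal states on classical registers -/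

section ClassicalBlock

open Matrix

variable {X Y A C : Type*} [DecidableEq X] [DecidableEq A]

/-- The operator `|a, x⟩⟨a, x| ⊗ τ`. -/
def classicalBlock {dE : ℕ} (a : A) (x : X) :
    Matrix (Fin dE) (Fin dE) ℂ →ₗ[ℂ] Matrix (A × (X × Fin dE)) (A × (X × Fin dE)) ℂ where
  toFun τ := Matrix.single a a (1 : ℂ) ⊗ₖ (Matrix.single x x (1 : ℂ) ⊗ₖ τ)
  map_add' σ τ := by rw [kronecker_add, kronecker_add]
  map_smul' c τ := by rw [kronecker_smul, kronecker_smul, RingHom.id_apply]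

lemma classicalBlock_apply {dE : ℕ} (a : A) (x : X) (τ : Matrix (Fin dE) (Fin dE) ℂ) :
    classicalBlock a x τ = Matrix.single a a (1 : ℂ) ⊗ₖ (Matrix.single x x (1 : ℂ) ⊗ₖ τ) := rfl

lemma posSemidef_single_one {n : Type*} [Fintype n] [DecidableEq n] (i : n) :
    (Matrix.single i i (1 : ℂ)).PosSemidef := by
  rw [← diagonal_single]
  exact PosSemidef.diagonal (Pi.single_nonneg.2 zero_le_one)

lemma posSemidef_classicalBlock [Fintype X] [Fintype A] {dE : ℕ} (a : A) (x : X) {τ : Matrix (Fin dE) (Fin dE) ℂ}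
    (hτ : τ.PosSemidef) : (classicalBlock a x τ).PosSemidef :=
  (posSemidef_single_one a).kronecker ((posSemidef_single_one x).kronecker hτ)

lemma trace_classicalBlock_mul [Fintype X] [Fintype A] {dE : ℕ} (a : A) (x : X) (τ : Matrix (Fin dE) (Fin dE) ℂ)
    (K : Matrix (A × (X × Fin dE)) (A × (X × Fin dE)) ℂ) :
    (classicalBlock a x τ * K).trace =
      (τ * K.submatrix (fun e => (a, x, e)) (fun e => (a, x, e))).trace := by
  simp only [classicalBlock_apply, Matrix.trace, Matrix.diag, Matrix.mul_apply,
    Fintype.sum_prod_type, kronecker_apply, Matrix.single_apply, submatrix_apply]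
  rw [Fintype.sum_eq_single a, Fintype.sum_eq_single x]
  · refine Finset.sum_congr rfl fun e _ => ?_
    rw [Fintype.sum_eq_single a, Fintype.sum_eq_single x]
    · simp
    · intro x' hx'; simp [hx'.symm]
    · intro a' ha'; simp [ha'.symm]
  · intro x' hx'; simp [hx'.symm]
  · intro a' ha'; simp [ha'.symm]

lemma trace_classicalBlock [Fintype X] [Fintype A] {dE : ℕ} (a : A) (x : X) (τ : Matrix (Fin dE) (Fin dE) ℂ) :
    (classicalBlock a x τ).trace = τ.trace := by
  simp [classicalBlock_apply, trace_kronecker]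

lemma reduceRight_classicalBlock [Fintype A] {dE : ℕ} (a : A) (x : X) (τ : Matrix (Fin dE) (Fin dE) ℂ) :
    reduceRight (classicalBlock a x τ) = Matrix.single x x (1 : ℂ) ⊗ₖ τ := by
  ext i j
  simp [reduceRight, classicalBlock_apply, Matrix.single_apply]

lemma reduceAXE_partialKey_single [Fintype Y] [DecidableEq Y] [Fintype C] [DecidableEq C] {dE : ℕ}
    (a : A) (c : Option C) (x : X) (y : Y) (t : Bool)
    (τ : Matrix (Fin dE) (Fin dE) ℂ) :
    reduceAXE (partialKey (Matrix.single (a, c, x, y, t) (a, c, x, y, t) (1 : ℂ) ⊗ₖ τ)) =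
      if t = false then classicalBlock a x τ else 0 := by
  ext ⟨a₁, x₁, e₁⟩ ⟨a₂, x₂, e₂⟩
  simp only [reduceAXE, partialKey, kronecker_apply, Matrix.single_apply, Prod.mk.injEq]
  rw [Fintype.sum_eq_single c, Fintype.sum_eq_single y, Fintype.sum_eq_single t]
  · by_cases ht : t = false
    · simp only [ht, true_and, and_true, if_true, classicalBlock_apply, kronecker_apply,
        Matrix.single_apply]
      by_cases h1 : a = a₁ <;> by_cases h2 : x = x₁ <;> by_cases h3 : a = a₂ <;>
        by_cases h4 : x = x₂ <;> simp [h1, h2, h3, h4]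
      all_goals simp_all
    · simp [ht]
  · intro t' ht'; simp [ht'.symm]
  · intro y' hy'; simp [hy'.symm]
  · intro c' hc'; simp [hc'.symm]

lemma testDataDist_single [Fintype X] [Fintype Y] [DecidableEq Y] [Fintype A] [DecidableEq C]
    {dE : ℕ} (a : A) (c c' : Option C) (x : X) (y : Y) (t : Bool)
    (τ : Matrix (Fin dE) (Fin dE) ℂ) :
    testDataDist (Matrix.single (a, c, x, y, t) (a, c, x, y, t) (1 : ℂ) ⊗ₖ τ) c' =
      if c = c' then τ.trace.re else 0 := by
  simp only [testDataDist, kronecker_apply, Matrix.single_apply, Prod.mk.injEq]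
  rw [Fintype.sum_eq_single a, Fintype.sum_eq_single x, Fintype.sum_eq_single y,
    Fintype.sum_eq_single t]
  · by_cases hc : c = c' <;> simp [hc, Matrix.trace, Complex.re_sum]
  · intro t' ht'; simp [ht'.symm]
  · intro y' hy'; simp [hy'.symm]
  · intro x' hx'; simp [hx'.symm]
  · intro a' ha'; simp [ha'.symm]

end ClassicalBlock

/-! ### Normalisation of the key state -/

section KeyState

open Matrix

variable {X Y A B C : Type*} [Fintype X] [DecidableEq X] [Fintype Y] [Fintype A] [DecidableEq A]
  {P : Protocol X Y A B C} {dA dB dE : ℕ}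

namespace Protocol

lemma trace_keyState (𝒟 : P.Device dA dB) (σ : NormalizedState dA dB dE) :
    (∑ x, (P.keyProb x : ℂ) • ∑ a : P.outA x, classicalBlock a.1 x (aliceState 𝒟 σ x a)).trace
      = 1 := by
  simp only [trace_sum, trace_smul, trace_classicalBlock]
  simp only [← trace_sum, sum_aliceState, trace_traceOutAB, σ.2.2, smul_eq_mul, mul_one]
  exact_mod_cast P.sum_keyProb

end Protocol

end KeyState

/-! ### Key state and test statistics of a round -/

section RoundOutput

open Matrix

variable {X Y A B C : Type*} [Fintype X] [DecidableEq X] [Fintype Y] [DecidableEq Y]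
  [Fintype A] [DecidableEq A] [Fintype C] [DecidableEq C]

/-- Restriction to the event `T = 0` as a linear map. -/
def partialKeyₗ {dE : ℕ} :
    Matrix (ClassicalReg X Y A C × Fin dE) (ClassicalReg X Y A C × Fin dE) ℂ →ₗ[ℂ]
      Matrix (ClassicalReg X Y A C × Fin dE) (ClassicalReg X Y A C × Fin dE) ℂ where
  toFun := partialKey
  map_add' ρ τ := by ext; simp only [partialKey, Matrix.add_apply]; split_ifs <;> simp
  map_smul' c ρ := by ext; simp only [partialKey, Matrix.smul_apply]; split_ifs <;> simp

/-- Reduction to the registers `A` and `X E` as a linear map. -/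
def reduceAXEₗ {dE : ℕ} :
    Matrix (ClassicalReg X Y A C × Fin dE) (ClassicalReg X Y A C × Fin dE) ℂ →ₗ[ℂ]
      Matrix (A × (X × Fin dE)) (A × (X × Fin dE)) ℂ where
  toFun := reduceAXE
  map_add' ρ τ := by ext; simp [reduceAXE, Finset.sum_add_distrib]
  map_smul' c ρ := by
    ext
    simp only [reduceAXE, Matrix.smul_apply, smul_eq_mul, Finset.mul_sum, RingHom.id_apply]

/-- The reduced state on the second factor as a linear map. -/
def reduceRightₗ {n k : Type*} [Fintype n] : Matrix (n × k) (n × k) ℂ →ₗ[ℂ] Matrix k k ℂ where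
  toFun := reduceRight
  map_add' ρ τ := by ext; simp [reduceRight, Finset.sum_add_distrib]
  map_smul' c ρ := by ext; simp [reduceRight, Finset.mul_sum]

/-- The weight of a value of the test data as a linear map. -/
def testDataDistₗ {dE : ℕ} (c : Option C) :
    Matrix (ClassicalReg X Y A C × Fin dE) (ClassicalReg X Y A C × Fin dE) ℂ →ₗ[ℝ] ℝ where
  toFun ρ := testDataDist ρ c
  map_add' ρ τ := by simp [testDataDist, Finset.sum_add_distrib]
  map_smul' r ρ := by
    simp only [testDataDist, Matrix.smul_apply, Complex.smul_re, smul_eq_mul, Finset.mul_sum,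
      RingHom.id_apply]

lemma trace_reduceAXE {dE : ℕ}
    (ρ : Matrix (ClassicalReg X Y A C × Fin dE) (ClassicalReg X Y A C × Fin dE) ℂ) :
    (reduceAXE ρ).trace = ρ.trace := by
  let e : (A × (X × Fin dE)) × (Option C × Y × Bool) ≃ ClassicalReg X Y A C × Fin dE :=
    { toFun := fun r => ((r.1.1, r.2.1, r.1.2.1, r.2.2.1, r.2.2.2), r.1.2.2)
      invFun := fun r => ((r.1.1, r.1.2.2.1, r.2), (r.1.2.1, r.1.2.2.2.1, r.1.2.2.2.2))
      left_inv := fun _ => rfl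
      right_inv := fun _ => rfl }
  have he : ∑ r, ρ (e r) (e r) = ρ.trace := Fintype.sum_equiv e _ _ fun _ => rfl
  rw [← he, Fintype.sum_prod_type]
  refine Finset.sum_congr rfl fun r _ => ?_
  rw [Fintype.sum_prod_type]
  refine Finset.sum_congr rfl fun c _ => ?_
  rw [Fintype.sum_prod_type]
  rfl

namespace Protocol

variable {P : Protocol X Y A B C} {dA dB dE : ℕ}

lemma trace_roundOutput (𝒟 : P.Device dA dB) (σ : NormalizedState dA dB dE) :
    (P.roundOutput 𝒟 σ).trace = 1 := by
  simp only [roundOutput, trace_sum, trace_smul, trace_kronecker, trace_single_eq_same, one_mul,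
    ← Finset.smul_sum]
  simp only [← trace_sum, sum_traceOutAB, sum_aliceState]
  simp only [trace_traceOutAB, σ.2.2, smul_eq_mul, mul_one]
  exact_mod_cast P.sum_inputProb

lemma reduceAXE_partialKey_roundOutput (𝒟 : P.Device dA dB) (σ : NormalizedState dA dB dE) :
    reduceAXE (partialKey (P.roundOutput 𝒟 σ)) = ((1 - P.γ : ℝ) : ℂ) •
      ∑ x, (P.keyProb x : ℂ) • ∑ a : P.outA x, classicalBlock a.1 x (aliceState 𝒟 σ x a) := by
  have e : reduceAXE (partialKey (P.roundOutput 𝒟 σ)) =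
      (reduceAXEₗ ∘ₗ partialKeyₗ) (P.roundOutput 𝒟 σ) := rfl
  rw [e, roundOutput]
  simp only [map_sum, map_smul, LinearMap.comp_apply]
  simp only [reduceAXEₗ, partialKeyₗ, LinearMap.coe_mk, AddHom.coe_mk,
    reduceAXE_partialKey_single, Fintype.sum_bool, Bool.true_eq_false, if_false, if_true, smul_zero,
    Finset.sum_const_zero, zero_add, ← Finset.smul_sum, ← map_sum, sum_traceOutAB]
  rw [Finset.smul_sum]
  refine Finset.sum_congr rfl fun x _ => ?_
  rw [← Finset.sum_smul, smul_smul]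
  congr 1
  simp [inputProb, keyProb, Finset.mul_sum]

/-- Conditioning divides by the weight `1 - γ` of key rounds, nonzero as `γ < 1`, so neither `γ` nor
the test inputs remain. -/
lemma reduceAXE_conditionKey_roundOutput (𝒟 : P.Device dA dB) (σ : NormalizedState dA dB dE) :
    reduceAXE (conditionKey (P.roundOutput 𝒟 σ)) =
      ∑ x, (P.keyProb x : ℂ) • ∑ a : P.outA x, classicalBlock a.1 x (aliceState 𝒟 σ x a) := by
  have htr : (partialKey (P.roundOutput 𝒟 σ)).trace = ((1 - P.γ : ℝ) : ℂ) := by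
    rw [← trace_reduceAXE, reduceAXE_partialKey_roundOutput, trace_smul, trace_keyState,
      smul_eq_mul, mul_one]
  have e : reduceAXE (conditionKey (P.roundOutput 𝒟 σ)) =
      (1 / ((1 - P.γ : ℝ) : ℂ)) • reduceAXE (partialKey (P.roundOutput 𝒟 σ)) := by
    rw [conditionKey, trace_roundOutput, htr]
    exact map_smul reduceAXEₗ _ _
  have hγ : ((1 - P.γ : ℝ) : ℂ) ≠ 0 := by
    exact_mod_cast (sub_pos.2 P.γ_lt_one).ne'
  rw [e, reduceAXE_partialKey_roundOutput, smul_smul, one_div, inv_mul_cancel₀ hγ, one_smul]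

lemma testDataDist_roundOutput (𝒟 : P.Device dA dB) (σ : NormalizedState dA dB dE)
    (c : Option C) :
    testDataDist (P.roundOutput 𝒟 σ) c = ∑ x, ∑ y, ∑ t, ∑ a : P.outA x, ∑ b : P.outB y,
      P.inputProb x y t * if P.testData a.1 b.1 x y t = c then
        ((𝒟.M x a ⊗ₖ (𝒟.N y b ⊗ₖ (1 : Matrix (Fin dE) (Fin dE) ℂ))) * σ.1).trace.re else 0 := by
  have e : testDataDist (P.roundOutput 𝒟 σ) c = testDataDistₗ c (P.roundOutput 𝒟 σ) := rfl
  rw [e, roundOutput]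
  simp only [Complex.coe_smul, map_sum, map_smul, smul_eq_mul]
  simp only [testDataDistₗ, LinearMap.coe_mk, AddHom.coe_mk, testDataDist_single, trace_traceOutAB]

end Protocol

end RoundOutput

/-! ### Bounding the key entropy by block-local operators -/

section KeyEntropy

open Matrix

/-- The quantity `Tr[ρ P(Z)] + Tr[σ Q(Z)]` for the polynomials `P`, `Q` of the quadrature. -/
def quadratureTrace {n : Type*} [Fintype n] (α : ℝ) {m : ℕ} (t w : Fin m → ℝ)
    (ρ σ : Matrix n n ℂ) (Z : Fin m → Matrix n n ℂ) : ℝ :=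
  ρ.trace.re + Real.sin (α * Real.pi) / Real.pi * ∑ i,
    (w i / t i * (ρ.trace.re + (ρ * Z i).trace.re + (ρ * (Z i)ᴴ).trace.re +
        (1 - t i) * (ρ * ((Z i)ᴴ * Z i)).trace.re) +
      w i * (σ * (Z i * (Z i)ᴴ)).trace.re)

/-- The difference is `Lᴴ * L`, where `L` consists of the rows of `K` outside the range of `f` and
the columns inside it: compression decreases second moments. -/
lemma posSemidef_submatrix_sub {n k : Type*} [Fintype n] [Fintype k] (K : Matrix n n ℂ)
    {f : k → n} (hf : Function.Injective f) :
    ((Kᴴ * K).submatrix f f - (K.submatrix f f)ᴴ * K.submatrix f f).PosSemidef := by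
  classical
  let L : Matrix n k ℂ := of fun r e => if r ∈ Set.range f then 0 else K r (f e)
  have : (Kᴴ * K).submatrix f f - (K.submatrix f f)ᴴ * K.submatrix f f = Lᴴ * L := by
    ext e e'
    simp only [Matrix.sub_apply, submatrix_apply, Matrix.mul_apply, conjTranspose_apply, L,
      of_apply]
    rw [sub_eq_iff_eq_add, ← Finset.sum_add_sum_compl (Finset.univ.image f), add_comm]
    congr 1
    · rw [← Finset.sum_add_sum_compl (Finset.univ.image f)
        (fun r => star (if r ∈ Set.range f then 0 else K r (f e)) *
          if r ∈ Set.range f then 0 else K r (f e')), Finset.sum_eq_zero (s := Finset.univ.image f),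
        zero_add]
      · refine Finset.sum_congr rfl fun r hr => ?_
        have hr' : r ∉ Set.range f := by simpa using hr
        simp [hr']
      · intro r hr
        have hr' : r ∈ Set.range f := by simpa using hr
        simp [hr']
    · rw [Finset.sum_image hf.injOn]
  rw [this]
  exact posSemidef_conjTranspose_mul_self L

lemma re_trace_mul_submatrix_le {n k : Type*} [Fintype n] [Fintype k] (K : Matrix n n ℂ)
    {f : k → n} (hf : Function.Injective f) {τ : Matrix k k ℂ} (hτ : τ.PosSemidef) :
    (τ * ((K.submatrix f f)ᴴ * K.submatrix f f)).trace.re ≤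
      (τ * (Kᴴ * K).submatrix f f).trace.re := by
  have := hτ.re_trace_mul_nonneg (posSemidef_submatrix_sub K hf)
  rw [mul_sub, trace_sub, Complex.sub_re] at this
  linarith

variable {X Y A B C : Type*} [Fintype X] [DecidableEq X] [Fintype Y] [Fintype A] [DecidableEq A]
  {P : Protocol X Y A B C} {dA dB dE : ℕ}

namespace Protocol

/-- The state of the registers `A`, `X` and the environment given `T = 0`. -/
def keyState (𝒟 : P.Device dA dB) (σ : NormalizedState dA dB dE) :
    Matrix (A × (X × Fin dE)) (A × (X × Fin dE)) ℂ :=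
  ∑ x, (P.keyProb x : ℂ) • ∑ a : P.outA x, classicalBlock a.1 x (aliceState 𝒟 σ x a)

lemma posSemidef_keyProb_smul {n : Type*} (x : X) {τ : Matrix n n ℂ} (hτ : τ.PosSemidef) :
    ((P.keyProb x : ℂ) • τ).PosSemidef :=
  hτ.smul (by exact_mod_cast P.keyProb_nonneg x)

lemma posSemidef_keyState (𝒟 : P.Device dA dB) (σ : NormalizedState dA dB dE) :
    (keyState 𝒟 σ).PosSemidef :=
  posSemidef_sum _ fun x _ => posSemidef_keyProb_smul x <| posSemidef_sum _ fun a _ =>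
    posSemidef_classicalBlock a.1 x (posSemidef_aliceState 𝒟 σ x a)

/-- Alice's conditional states sum to Eve's reduced state for every `x`, so the side information
splits into identical blocks. They range over all of `A`, including labels impossible on input `x`.
-/
lemma one_kronecker_reduceRight_keyState (𝒟 : P.Device dA dB) (σ : NormalizedState dA dB dE) :
    (1 : Matrix A A ℂ) ⊗ₖ reduceRight (keyState 𝒟 σ) =
      ∑ x, (P.keyProb x : ℂ) • ∑ a : A, classicalBlock a x (traceOutAB σ.1) := by
  have h1 : reduceRight (keyState 𝒟 σ) =
      ∑ x, (P.keyProb x : ℂ) • (Matrix.single x x (1 : ℂ) ⊗ₖ traceOutAB σ.1) := by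
    have e : reduceRight (keyState 𝒟 σ) = reduceRightₗ (keyState 𝒟 σ) := rfl
    rw [e, keyState]
    simp only [map_sum, map_smul]
    simp only [reduceRightₗ, LinearMap.coe_mk, AddHom.coe_mk, reduceRight_classicalBlock,
      ← kronecker_finsetSum, sum_aliceState]
  have h2 : (1 : Matrix A A ℂ) = ∑ a, Matrix.single a a (1 : ℂ) := by
    ext i j
    rw [Matrix.sum_apply, Fintype.sum_eq_single i]
    · simp [Matrix.one_apply, Matrix.single_apply]
    · intro a ha; simp [ha]
  rw [h1, kronecker_finsetSum]
  refine Finset.sum_congr rfl fun x _ => ?_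
  rw [kronecker_smul, h2, finsetSum_kronecker]
  rfl

lemma posSemidef_eve_sub_alice (𝒟 : P.Device dA dB) (σ : NormalizedState dA dB dE) (x : X)
    (a : P.outA x) : (traceOutAB σ.1 - aliceState 𝒟 σ x a).PosSemidef := by
  rw [← sum_aliceState 𝒟 σ x, ← Finset.add_sum_erase _ _ (Finset.mem_univ a), add_sub_cancel_left]
  exact posSemidef_sum _ fun b _ => posSemidef_aliceState 𝒟 σ x b

/-- As `A` is classical, the comparison is blockwise: a possible outcome's state is one summand of
Eve's state, and the blocks of impossible outcomes are positive. -/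
lemma posSemidef_one_kronecker_sub_keyState (𝒟 : P.Device dA dB) (σ : NormalizedState dA dB dE) :
    ((1 : Matrix A A ℂ) ⊗ₖ reduceRight (keyState 𝒟 σ) - keyState 𝒟 σ).PosSemidef := by
  rw [one_kronecker_reduceRight_keyState, keyState, ← Finset.sum_sub_distrib]
  refine posSemidef_sum _ fun x _ => ?_
  rw [← smul_sub]
  refine posSemidef_keyProb_smul x ?_
  rw [← Finset.sum_add_sum_compl (P.outA x), ← Finset.sum_coe_sort (P.outA x), add_sub_right_comm,
    ← Finset.sum_sub_distrib]
  refine PosSemidef.add (posSemidef_sum _ fun a _ => ?_) (posSemidef_sum _ fun a _ => ?_)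
  · rw [← map_sub]
    exact posSemidef_classicalBlock _ _ (posSemidef_eve_sub_alice 𝒟 σ x a)
  · exact posSemidef_classicalBlock _ _ σ.2.1.traceOutAB

/-- For `0 ≤ ρ ≤ τ` the quadratic form of `ρ` vanishes on the kernel of `τ`. Hence the divergence is
always finite here. -/
lemma keyState_ker (𝒟 : P.Device dA dB) (σ : NormalizedState dA dB dE)
    (v : A × (X × Fin dE) → ℂ)
    (hv : ((1 : Matrix A A ℂ) ⊗ₖ reduceRight (keyState 𝒟 σ)) *ᵥ v = 0) :
    keyState 𝒟 σ *ᵥ v = 0 := by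
  have h1 := (posSemidef_one_kronecker_sub_keyState 𝒟 σ).dotProduct_mulVec_nonneg v
  rw [sub_mulVec, hv, zero_sub, dotProduct_neg, neg_nonneg] at h1
  exact ((posSemidef_keyState 𝒟 σ).dotProduct_mulVec_zero_iff v).1
    (le_antisymm h1 ((posSemidef_keyState 𝒟 σ).dotProduct_mulVec_nonneg v))

/-- Restricting the operators of the variational bound to the blocks of the classical registers
does not decrease the bound. -/
lemma quadratureTrace_keyState_le {α : ℝ} (hα : α ∈ Set.Ioo (1 : ℝ) 2) {m : ℕ}
    {t w : Fin m → ℝ} (h : IsGaussRadauJacobi α t w) (𝒟 : P.Device dA dB)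
    (σ : NormalizedState dA dB dE) (Z : Fin m → Matrix (A × (X × Fin dE)) (A × (X × Fin dE)) ℂ) :
    quadratureTrace α t w (keyState 𝒟 σ) ((1 : Matrix A A ℂ) ⊗ₖ reduceRight (keyState 𝒟 σ)) Z ≤
      ∑ x, P.keyProb x * ∑ a : P.outA x,
        quadratureTrace α t w (aliceState 𝒟 σ x a) (traceOutAB σ.1)
          (fun i => (Z i).submatrix (fun e => (a.1, x, e)) (fun e => (a.1, x, e))) := by
  have hinj : ∀ (a : A) (x : X), Function.Injective (fun e : Fin dE => (a, x, e)) :=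
    fun a x e e' h => by simpa using h
  have hc : Real.sin (α * Real.pi) / Real.pi ≤ 0 :=
    (div_neg_of_neg_of_pos (sin_mul_pi_neg hα) Real.pi_pos).le
  have htr : (keyState 𝒟 σ).trace.re =
      ∑ x, P.keyProb x * ∑ a : P.outA x, (aliceState 𝒟 σ x a).trace.re := by
    simp only [keyState, trace_sum, trace_smul, trace_classicalBlock, Complex.re_sum, smul_eq_mul,
      Complex.re_ofReal_mul]
  have hρ : ∀ K, (keyState 𝒟 σ * K).trace.re = ∑ x, P.keyProb x * ∑ a : P.outA x,
      (aliceState 𝒟 σ x a *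
        K.submatrix (fun e => (a.1, x, e)) (fun e => (a.1, x, e))).trace.re := by
    intro K
    simp only [keyState, Finset.sum_mul, smul_mul_assoc, trace_sum, trace_smul,
      trace_classicalBlock_mul, Complex.re_sum, smul_eq_mul, Complex.re_ofReal_mul]
  have hσ : ∀ K, (((1 : Matrix A A ℂ) ⊗ₖ reduceRight (keyState 𝒟 σ)) * K).trace.re =
      ∑ x, P.keyProb x * ∑ a : A,
        (traceOutAB σ.1 * K.submatrix (fun e => (a, x, e)) (fun e => (a, x, e))).trace.re := by
    intro K
    rw [one_kronecker_reduceRight_keyState]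
    simp only [Finset.sum_mul, smul_mul_assoc, trace_sum, trace_smul,
      trace_classicalBlock_mul, Complex.re_sum, smul_eq_mul, Complex.re_ofReal_mul]
  have hZZ : ∀ i, (∑ x, P.keyProb x * ∑ a : P.outA x, (aliceState 𝒟 σ x a *
      (((Z i).submatrix (fun e => (a.1, x, e)) (fun e => (a.1, x, e)))ᴴ *
        (Z i).submatrix (fun e => (a.1, x, e)) (fun e => (a.1, x, e)))).trace.re) ≤
      (keyState 𝒟 σ * ((Z i)ᴴ * Z i)).trace.re := by
    intro i
    rw [hρ]
    exact Finset.sum_le_sum fun x _ => mul_le_mul_of_nonneg_left (Finset.sum_le_sum fun a _ =>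
      re_trace_mul_submatrix_le _ (hinj _ _) (posSemidef_aliceState 𝒟 σ x a)) (P.keyProb_nonneg x)
  have hZZ' : ∀ i, (∑ x, P.keyProb x * ∑ a : P.outA x, (traceOutAB σ.1 *
      ((Z i).submatrix (fun e => (a.1, x, e)) (fun e => (a.1, x, e)) *
        ((Z i).submatrix (fun e => (a.1, x, e)) (fun e => (a.1, x, e)))ᴴ)).trace.re) ≤
      (((1 : Matrix A A ℂ) ⊗ₖ reduceRight (keyState 𝒟 σ)) * (Z i * (Z i)ᴴ)).trace.re := by
    intro i
    rw [hσ]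
    refine Finset.sum_le_sum fun x _ => mul_le_mul_of_nonneg_left ?_ (P.keyProb_nonneg x)
    -- The labels outside `outA x` contribute nonnegative terms, which are dropped.
    rw [← Finset.sum_add_sum_compl (P.outA x), ← Finset.sum_coe_sort (P.outA x)]
    refine le_add_of_le_of_nonneg (Finset.sum_le_sum fun a _ => ?_)
      (Finset.sum_nonneg fun a _ => ?_)
    · have := re_trace_mul_submatrix_le ((Z i)ᴴ) (hinj a.1 x) σ.2.1.traceOutAB
      simpa only [conjTranspose_submatrix, conjTranspose_conjTranspose] using this
    · have h1 : (Z i * (Z i)ᴴ).PosSemidef := posSemidef_self_mul_conjTranspose _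
      exact σ.2.1.traceOutAB.re_trace_mul_nonneg (h1.submatrix _)
  have hrhs : ∑ x, P.keyProb x * ∑ a : P.outA x,
        quadratureTrace α t w (aliceState 𝒟 σ x a) (traceOutAB σ.1)
          (fun i => (Z i).submatrix (fun e => (a.1, x, e)) (fun e => (a.1, x, e))) =
      (keyState 𝒟 σ).trace.re + Real.sin (α * Real.pi) / Real.pi * ∑ i,
        (w i / t i * ((keyState 𝒟 σ).trace.re + (keyState 𝒟 σ * Z i).trace.re +
          (keyState 𝒟 σ * (Z i)ᴴ).trace.re + (1 - t i) *
            (∑ x, P.keyProb x * ∑ a : P.outA x, (aliceState 𝒟 σ x a *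
              (((Z i).submatrix (fun e => (a.1, x, e)) (fun e => (a.1, x, e)))ᴴ *
              (Z i).submatrix (fun e => (a.1, x, e)) (fun e => (a.1, x, e)))).trace.re)) +
        w i * (∑ x, P.keyProb x * ∑ a : P.outA x, (traceOutAB σ.1 *
          ((Z i).submatrix (fun e => (a.1, x, e)) (fun e => (a.1, x, e)) *
            ((Z i).submatrix (fun e => (a.1, x, e)) (fun e => (a.1, x, e)))ᴴ)).trace.re)) := by
    -- Treating the weighted sum over `(x, a)` as one linear functional reduces the rearrangement to
    -- linearity.
    let Av : ((x : X) → P.outA x → ℝ) →ₗ[ℝ] ℝ :=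
      { toFun := fun F => ∑ x, P.keyProb x * ∑ a, F x a
        map_add' := fun F G => by simp [Finset.sum_add_distrib, mul_add]
        map_smul' := fun c F => by
          simp only [Pi.smul_apply, smul_eq_mul, ← Finset.mul_sum, RingHom.id_apply]
          rw [Finset.mul_sum]
          exact Finset.sum_congr rfl fun x _ => mul_left_comm _ _ _ }
    let S : (i : Fin m) → (x : X) → P.outA x → Matrix (Fin dE) (Fin dE) ℂ := fun i x a =>
      (Z i).submatrix (fun e => (a.1, x, e)) (fun e => (a.1, x, e))
    let F : (K : (x : X) → P.outA x → Matrix (Fin dE) (Fin dE) ℂ) → (x : X) → P.outA x → ℝ :=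
      fun K x a => (aliceState 𝒟 σ x a * K x a).trace.re
    let F₀ : (x : X) → P.outA x → ℝ := fun x a => (aliceState 𝒟 σ x a).trace.re
    let F₁ : Fin m → (x : X) → P.outA x → ℝ := fun i x a =>
      (traceOutAB σ.1 * (S i x a * (S i x a)ᴴ)).trace.re
    have key : Av (F₀ + (Real.sin (α * Real.pi) / Real.pi) • ∑ i, ((w i / t i) • (F₀ + F (S i) +
        F (fun x a => (S i x a)ᴴ) + (1 - t i) • F (fun x a => (S i x a)ᴴ * S i x a)) +
        w i • F₁ i)) = Av F₀ + Real.sin (α * Real.pi) / Real.pi * ∑ i, (w i / t i * (Av F₀ +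
        Av (F (S i)) + Av (F (fun x a => (S i x a)ᴴ)) +
          (1 - t i) * Av (F (fun x a => (S i x a)ᴴ * S i x a))) + w i * Av (F₁ i)) := by
      simp only [map_add, map_smul, map_sum, smul_eq_mul]
    rw [htr]
    simp only [hρ]
    refine Eq.trans (Finset.sum_congr rfl fun x _ => ?_) key
    congr 1
    refine Finset.sum_congr rfl fun a _ => ?_
    simp only [Pi.add_apply, Pi.smul_apply, Finset.sum_apply, smul_eq_mul, quadratureTrace]
    rfl
  rw [hrhs, quadratureTrace]
  -- The sum over `i` shrinks under compression, as `w i`, `t i` and `1 - t i` are nonnegative; the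
  -- negative prefactor makes the total grow.
  refine add_le_add_right (mul_le_mul_of_nonpos_left (Finset.sum_le_sum fun i _ => ?_) hc) _
  have ht := h.node_pos hα i
  have hw := h.weight_pos hα i
  refine add_le_add (mul_le_mul_of_nonneg_left (add_le_add_right
    (mul_le_mul_of_nonneg_left (hZZ i) (sub_nonneg.2 (h.le_one i))) _) (by positivity))
    (mul_le_mul_of_nonneg_left (hZZ' i) hw.le)

variable [DecidableEq Y] [Fintype C] [DecidableEq C]

/-- The entropy of a round is determined by a quantity with a rational upper bound. -/
theorem exists_keyEntropy_bound {α : ℝ} (hα : α ∈ Set.Ioo (1 : ℝ) 2) {m : ℕ} (hm : 1 ≤ m)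
    {t w : Fin m → ℝ} (h : IsGaussRadauJacobi α t w) (𝒟 : P.Device dA dB)
    (σ : NormalizedState dA dB dE) :
    ∃ r : ℝ, 0 < r ∧
      keyEntropy α (P.roundOutput 𝒟 σ) = ((-(1 / (α - 1) * Real.logb 2 r) : ℝ) : EReal) ∧
      ∃ Z : (x : X) → P.outA x → Fin m → Matrix (Fin dE) (Fin dE) ℂ,
        r ≤ ∑ x, P.keyProb x * ∑ a : P.outA x,
          quadratureTrace α t w (aliceState 𝒟 σ x a) (traceOutAB σ.1) (Z x a) := by
  have hker := keyState_ker 𝒟 σ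
  have htr : (keyState 𝒟 σ).trace = 1 := trace_keyState 𝒟 σ
  have hpos := posSemidef_keyState 𝒟 σ
  have hpos' : ((1 : Matrix A A ℂ) ⊗ₖ reduceRight (keyState 𝒟 σ)).PosSemidef := by
    have := (posSemidef_one_kronecker_sub_keyState 𝒟 σ).add hpos
    rwa [sub_add_cancel] at this
  refine ⟨(matPow (keyState 𝒟 σ) α *
    matPow ((1 : Matrix A A ℂ) ⊗ₖ reduceRight (keyState 𝒟 σ)) (1 - α)).trace.re, ?_, ?_, ?_⟩
  · exact re_trace_matPow_mul_matPow_pos hpos hpos' hker (by rw [htr]; exact zero_lt_one) α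
  · have e : reduceAXE (conditionKey (P.roundOutput 𝒟 σ)) = keyState 𝒟 σ :=
      reduceAXE_conditionKey_roundOutput 𝒟 σ
    rw [keyEntropy, petzCondEntropy, e, petzDivergence, if_pos (Or.inr hker), htr, Complex.one_re,
      div_one, EReal.coe_neg]
  · obtain ⟨Z, hZ⟩ := h.exists_trace_le hα hm hpos hpos' hker
    exact ⟨_, hZ.trans (quadratureTrace_keyState_le hα h 𝒟 σ Z)⟩

end Protocol

end KeyEntropy

/-! ### Simultaneous Naimark dilation -/

section Naimark

universe u v w

open Matrix

/-- An isometry is the corner of a self-adjoint unitary. -/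
lemma exists_selfAdjoint_unitary_fromBlocks {n k : Type*} [Fintype n] [DecidableEq n] [Fintype k]
    [DecidableEq k] {W : Matrix k n ℂ} (hW : Wᴴ * W = 1) :
    (fromBlocks 0 Wᴴ W (1 - W * Wᴴ))ᴴ = fromBlocks 0 Wᴴ W (1 - W * Wᴴ) ∧
      fromBlocks 0 Wᴴ W (1 - W * Wᴴ) * fromBlocks 0 Wᴴ W (1 - W * Wᴴ) = 1 := by
  have h1 : W * Wᴴ * (W * Wᴴ) = W * Wᴴ := by
    rw [Matrix.mul_assoc, ← Matrix.mul_assoc Wᴴ, hW, Matrix.one_mul]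
  constructor
  · rw [fromBlocks_conjTranspose]
    simp
  · rw [fromBlocks_multiply, ← fromBlocks_one]
    congr 1
    · rw [Matrix.zero_mul, zero_add, hW]
    · rw [Matrix.zero_mul, zero_add, Matrix.mul_sub, Matrix.mul_one, ← Matrix.mul_assoc, hW,
        Matrix.one_mul, sub_self]
    · rw [Matrix.mul_zero, zero_add, Matrix.sub_mul, Matrix.one_mul, Matrix.mul_assoc, hW,
        Matrix.mul_one, sub_self]
    · rw [sub_mul, one_mul, mul_sub, mul_one, h1]
      abel

/-- Naimark dilation of finitely many measurements: they are the compressions of projective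
measurements under one common isometry. -/
theorem exists_projective_dilation {X : Type u} [Fintype X] {O : X → Type v}
    [∀ x, Fintype (O x)] [∀ x, Nonempty (O x)] {n : Type w} [Fintype n] [DecidableEq n]
    (M : ∀ x, O x → Matrix n n ℂ) (hM : ∀ x a, (M x a).PosSemidef) (hsum : ∀ x, ∑ a, M x a = 1) :
    ∃ (k : Type (max u v w)) (_ : Fintype k) (_ : DecidableEq k) (V : Matrix k n ℂ)
      (E : ∀ x, O x → Matrix k k ℂ), Vᴴ * V = 1 ∧ (∀ x a, (E x a)ᴴ = E x a) ∧
      (∀ x a, E x a * E x a = E x a) ∧ (∀ x, ∑ a, E x a = 1) ∧ ∀ x a, Vᴴ * E x a * V = M x a := by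
  classical
  choose F hF using fun x a => (hM x a).exists_eq_conjTranspose_mul_self
  let W : X → Matrix (n × Σ x, O x) n ℂ := fun x =>
    of fun r j => if r.2.1 = x then F r.2.1 r.2.2 r.1 j else 0
  let a₀ : ∀ x, O x := fun x => Classical.arbitrary _
  -- Rows belonging to another input, and below the whole original space, are assigned the default
  -- outcome `a₀ x`; the coordinate projections thus sum to the identity for each `x`.
  let lab : ∀ x, (Σ x, O x) → O x := fun x s => if h : s.1 = x then h ▸ s.2 else a₀ x
  let d₁ : ∀ x, O x → n → ℂ := fun x a _ => if a₀ x = a then 1 else 0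
  let d₂ : ∀ x, O x → (n × Σ x, O x) → ℂ := fun x a r => if lab x r.2 = a then 1 else 0
  have hWD : ∀ x a, (W x)ᴴ * diagonal (d₂ x a) * W x = M x a := by
    intro x a
    ext i j
    rw [Matrix.mul_apply, hF, Matrix.mul_apply, Fintype.sum_prod_type]
    refine Finset.sum_congr rfl fun h _ => ?_
    rw [Fintype.sum_sigma, Fintype.sum_eq_single x, Fintype.sum_eq_single a]
    · simp [Matrix.mul_diagonal, W, d₂, lab]
    · intro b hb; simp [Matrix.mul_diagonal, W, d₂, lab, hb]
    · intro y hy; simp [Matrix.mul_diagonal, W, hy]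
  have hd₁ : ∀ x, ∑ a, diagonal (d₁ x a) = (1 : Matrix n n ℂ) := by
    intro x
    ext i j
    rw [Matrix.sum_apply]
    by_cases hij : i = j <;> simp [hij, d₁, Matrix.one_apply]
  have hd₂ : ∀ x, ∑ a, diagonal (d₂ x a) = (1 : Matrix (n × Σ x, O x) (n × Σ x, O x) ℂ) := by
    intro x
    ext i j
    rw [Matrix.sum_apply]
    by_cases hij : i = j
    · simp [hij, d₂, Matrix.one_apply]
    · simp [hij]
  have hW : ∀ x, (W x)ᴴ * W x = 1 := by
    intro x
    rw [← hsum x, ← Finset.sum_congr rfl fun a _ => hWD x a, ← Matrix.sum_mul, ← Matrix.mul_sum,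
      hd₂, Matrix.mul_one]
  let U : ∀ x, Matrix (n ⊕ n × Σ x, O x) (n ⊕ n × Σ x, O x) ℂ := fun x =>
    fromBlocks 0 (W x)ᴴ (W x) (1 - W x * (W x)ᴴ)
  let D : ∀ x, O x → Matrix (n ⊕ n × Σ x, O x) (n ⊕ n × Σ x, O x) ℂ := fun x a =>
    fromBlocks (diagonal (d₁ x a)) 0 0 (diagonal (d₂ x a))
  have hU : ∀ x, (U x)ᴴ = U x := fun x => (exists_selfAdjoint_unitary_fromBlocks (hW x)).1
  have hU2 : ∀ x, U x * U x = 1 := fun x => (exists_selfAdjoint_unitary_fromBlocks (hW x)).2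
  have hDH : ∀ x a, (D x a)ᴴ = D x a := by
    intro x a
    simp only [D, fromBlocks_conjTranspose, diagonal_conjTranspose, conjTranspose_zero]
    congr 2
    · ext i; simp only [d₁, Pi.star_apply]; split_ifs <;> simp
    · ext i; simp only [d₂, Pi.star_apply]; split_ifs <;> simp
  have hD2 : ∀ x a, D x a * D x a = D x a := by
    intro x a
    simp only [D, fromBlocks_multiply, diagonal_mul_diagonal, Matrix.mul_zero, Matrix.zero_mul,
      add_zero, zero_add]
    congr 2
    · ext i; simp [d₁]
    · ext i; simp [d₂]
  have hDs : ∀ x, ∑ a, D x a = 1 := by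
    intro x
    rw [← fromBlocks_one, ← hd₁ x, ← hd₂ x]
    ext (i | i) (j | j) <;> simp [D, Matrix.sum_apply, -fromBlocks_diagonal]
  -- The upper left corner of `U x` is zero, so that of `U x * D x a * U x` is `(W x)ᴴ * diagonal
  -- (d₂ x a) * W x`. The embedding `fromRows 1 0` does not depend on `x`.
  refine ⟨n ⊕ n × Σ x, O x, inferInstance, inferInstance, fromRows 1 0,
    fun x a => U x * D x a * U x, ?_, fun x a => ?_, fun x a => ?_, fun x => ?_, fun x a => ?_⟩
  · rw [conjTranspose_fromRows_eq_fromCols_conjTranspose, fromCols_mul_fromRows]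
    simp
  · simp only [conjTranspose_mul, hU, hDH, mul_assoc]
  · have : U x * D x a * U x * (U x * D x a * U x) = U x * (D x a * (U x * U x) * D x a) * U x := by
      simp only [mul_assoc]
    rw [this, hU2, mul_one, hD2]
  · rw [← Finset.sum_mul, ← Finset.mul_sum, hDs, mul_one, hU2]
  · simp only [U, D, fromBlocks_multiply, conjTranspose_fromRows_eq_fromCols_conjTranspose]
    rw [← hWD x a]
    simp [fromCols_mul_fromBlocks, fromCols_mul_fromRows]

end Naimark

/-! ### Moments of matrices and positivity of the moment matrix -/

section MomentMatrix

open Matrix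

/-- The set of blocks need not be finite: a finitely supported vector meets only finitely many of
them. -/
lemma posSemidef_blockDiagonal' {o : Type*} [DecidableEq o] {k : o → Type*}
    [∀ i, Fintype (k i)] {K : ∀ i, Matrix (k i) (k i) ℝ} (hK : ∀ i, (K i).PosSemidef) :
    (blockDiagonal' K).PosSemidef := by
  classical
  refine ⟨?_, fun x => ?_⟩
  · rw [IsHermitian, blockDiagonal'_conjTranspose]
    congr 1
    ext1 i
    exact (hK i).1
  · let J : Finset o := x.support.image Sigma.fst
    let T : Finset (Σ i, k i) := J.sigma fun _ => Finset.univ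
    have hT : x.support ⊆ T := fun p hp => by
      simp only [T, J, Finset.mem_sigma, Finset.mem_univ, and_true]
      exact Finset.mem_image_of_mem _ hp
    rw [Finsupp.sum_of_support_subset x hT _ (by simp)]
    have h1 : ∀ p ∈ T, (x.sum fun q xq => star (x p) * blockDiagonal' K p q * xq) =
        ∑ b : k p.1, star (x p) * K p.1 p.2 b * x ⟨p.1, b⟩ := by
      rintro ⟨i, a⟩ hp
      have hi : i ∈ J := (Finset.mem_sigma.1 hp).1
      rw [Finsupp.sum_of_support_subset x hT _ (by simp), Finset.sum_sigma,
        Finset.sum_eq_single_of_mem i hi]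
      · exact Finset.sum_congr rfl fun b _ => by rw [blockDiagonal'_apply_eq]
      · intro j _ hj
        exact Finset.sum_eq_zero fun b _ => by
          rw [blockDiagonal'_apply_ne _ _ _ (Ne.symm hj), mul_zero, zero_mul]
    rw [Finset.sum_congr rfl h1, Finset.sum_sigma]
    refine Finset.sum_nonneg fun i _ => ?_
    have := (hK i).dotProduct_mulVec_nonneg fun a => x ⟨i, a⟩
    simpa only [dotProduct, mulVec, Finset.mul_sum, Pi.star_apply, mul_assoc] using this

/-- At a real vector `c` the quadratic form is the trace of `Tᴴ * K * T * S` with `T = ∑ c u • R u`.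
-/
lemma posSemidef_re_trace_gram {n ι : Type*} [Fintype n] [Fintype ι] {K S : Matrix n n ℂ}
    (hK : K.PosSemidef) (hS : S.PosSemidef) (R : ι → Matrix n n ℂ) :
    (of fun u v => ((R u)ᴴ * K * R v * S).trace.re : Matrix ι ι ℝ).PosSemidef := by
  refine PosSemidef.of_dotProduct_mulVec_nonneg ?_ fun c => ?_
  · ext u v
    rw [conjTranspose_apply, of_apply, of_apply, star_trivial]
    have : ((R v)ᴴ * K * R u * S).trace = star ((R u)ᴴ * K * R v * S).trace := by
      rw [← trace_conjTranspose, conjTranspose_mul, conjTranspose_mul, conjTranspose_mul,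
        conjTranspose_conjTranspose, hS.1.eq, hK.1.eq, trace_mul_comm, mul_assoc]
    rw [this, Complex.star_def, Complex.conj_re]
  · have h1 : 0 ≤ ((∑ u, (c u : ℂ) • R u)ᴴ * K * (∑ u, (c u : ℂ) • R u) * S).trace.re :=
      (hK.conjTranspose_mul_mul_same _).re_trace_mul_nonneg hS
    refine h1.trans_eq ?_
    simp only [conjTranspose_sum, conjTranspose_smul, Finset.sum_mul, Finset.mul_sum, trace_sum,
      smul_mul_assoc, mul_smul_comm, trace_smul, Complex.re_sum, dotProduct, mulVec, of_apply,
      smul_eq_mul, Complex.star_def, Complex.conj_ofReal, Complex.re_ofReal_mul, Pi.star_apply,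
      star_trivial]
    rw [Finset.sum_comm]
    refine Finset.sum_congr rfl fun u _ => Finset.sum_congr rfl fun v _ => ?_
    ring

variable {X Y A B C : Type*} [Fintype X] [Fintype Y] {P : Protocol X Y A B C} {m : ℕ}
  {n : Type*} [Fintype n] [DecidableEq n]

/-- The evaluation of noncommutative polynomials at given matrices. -/
def ncEval (r : Letter P m → Matrix n n ℂ) : NCPoly P m →ₐ[ℝ] Matrix n n ℂ :=
  MonoidAlgebra.lift ℝ (Matrix n n ℂ) (NCWord P m) (FreeMonoid.lift r)

lemma ncEval_mono (r : Letter P m → Matrix n n ℂ) (u : NCWord P m) :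
    ncEval r (mono u) = FreeMonoid.lift r u :=
  MonoidAlgebra.lift_of _ _

lemma ncEval_ncVar (r : Letter P m → Matrix n n ℂ) (l : Letter P m) :
    ncEval r (ncVar l) = r l := by
  rw [ncVar, ncEval_mono, FreeMonoid.lift_eval_of]

lemma ncEval_mono_adj {r : Letter P m → Matrix n n ℂ} (hr : ∀ l, r l.adj = (r l)ᴴ)
    (u : NCWord P m) : ncEval r (mono u.adj) = (ncEval r (mono u))ᴴ := by
  rw [ncEval_mono, ncEval_mono]
  induction u using FreeMonoid.inductionOn' with
  | one => simp [NCWord.adj]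
  | of_mul l u ih =>
    have : NCWord.adj (FreeMonoid.of l * u) = NCWord.adj u * FreeMonoid.of l.adj := by
      simp [NCWord.adj]
    rw [this, map_mul, map_mul, ih, FreeMonoid.lift_eval_of, FreeMonoid.lift_eval_of,
      conjTranspose_mul, hr]

namespace NPARelaxation

variable {α : ℝ} {t w : Fin m → ℝ} (R : NPARelaxation P α t w)

/-- The values of the variables of the relaxation at given matrices and a given state. -/
def moments (r : Letter P m → Matrix n n ℂ) (S : Matrix n n ℂ) : R.words → ℝ :=
  fun u => (ncEval r (mono u.1) * S).trace.re

lemma lin_moments (r : Letter P m → Matrix n n ℂ) (S : Matrix n n ℂ) {p : NCPoly P m}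
    (hp : p.coeff.support ⊆ R.words) :
    R.lin p (R.moments r S) = (ncEval r p * S).trace.re := by
  have e : ncEval r p = ∑ u ∈ R.words, p.coeff u • ncEval r (mono u) := by
    rw [ncEval, MonoidAlgebra.lift_apply, Finsupp.sum_of_support_subset _ hp _ (by simp)]
    exact Finset.sum_congr rfl fun u _ => by rw [← ncEval_mono]; rfl
  rw [e, Finset.sum_mul, trace_sum, Complex.re_sum, lin]
  refine (Finset.sum_coe_sort R.words
    fun u => p.coeff u * (ncEval r (mono u) * S).trace.re).trans ?_
  refine Finset.sum_congr rfl fun u _ => ?_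
  rw [smul_mul_assoc, trace_smul, Complex.smul_re, smul_eq_mul]

/-- Every constraint polynomial evaluates to a positive matrix, the equations in both signs to zero,
so each block is a Gram matrix. -/
lemma posSemidef_momentMatrix {r : Letter P m → Matrix n n ℂ} (hr : ∀ l, r l.adj = (r l)ᴴ)
    (hA : ∀ x a, (r (.alice x a)).PosSemidef) (hB : ∀ y b, (r (.bob y b)).PosSemidef)
    (hrel : ∀ k : NPARelation P m, ncEval r k.poly = 0) {S : Matrix n n ℂ} (hS : S.PosSemidef) :
    (R.momentMatrix (R.moments r S)).PosSemidef := by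
  classical
  rw [momentMatrix]
  refine posSemidef_blockDiagonal' fun j => ?_
  have hj : (ncEval r j.poly).PosSemidef := by
    cases j with
    | unit => simpa [NPAConstraint.poly] using PosSemidef.one
    | posA x a => simpa only [NPAConstraint.poly, ncEval_ncVar] using hA x a
    | posB y b => simpa only [NPAConstraint.poly, ncEval_ncVar] using hB y b
    | eqNonneg k => simpa only [NPAConstraint.poly, hrel] using PosSemidef.zero
    | eqNonpos k => simpa only [NPAConstraint.poly, map_neg, hrel, neg_zero] using PosSemidef.zero
  convert! posSemidef_re_trace_gram hj hS fun u : R.index j => ncEval r (mono u.1) using 1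
  ext u v
  rw [of_apply, of_apply, R.lin_moments r S (R.entry_mem j u.1 u.2 v.1 v.2), map_mul, map_mul,
    ncEval_mono_adj hr]

end NPARelaxation

end MomentMatrix

/-! ### Matrix realisation of the noncommuting variables -/

section Realization

open Matrix

variable {kA kB nA nB nE : Type*} [Fintype kA] [DecidableEq kA] [Fintype kB] [DecidableEq kB]
  [Fintype nA] [DecidableEq nA] [Fintype nB] [DecidableEq nB] [Fintype nE] [DecidableEq nE]

/-- Operators of the environment as operators of the whole system. -/
def eveEmbedding (kA kB nE : Type*) [Fintype kA] [DecidableEq kA] [Fintype kB] [DecidableEq kB]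
    [Fintype nE] [DecidableEq nE] :
    Matrix nE nE ℂ →ₐ[ℝ] Matrix (kA × kB × nE) (kA × kB × nE) ℂ where
  toFun K := (1 : Matrix kA kA ℂ) ⊗ₖ ((1 : Matrix kB kB ℂ) ⊗ₖ K)
  map_one' := by rw [one_kronecker_one, one_kronecker_one]
  map_mul' K L := by
    rw [← mul_kronecker_mul, ← mul_kronecker_mul, Matrix.one_mul, Matrix.one_mul]
  map_zero' := by rw [kronecker_zero, kronecker_zero]
  map_add' K L := by rw [kronecker_add, kronecker_add]
  commutes' r := by
    rw [Algebra.algebraMap_eq_smul_one, Algebra.algebraMap_eq_smul_one, kronecker_smul,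
      kronecker_smul, one_kronecker_one, one_kronecker_one]

/-- Cyclicity moves the dilating isometries from the state to the operators, where they compress the
projections back to the POVM elements. -/
lemma trace_kronecker_mul_dilated (VA : Matrix kA nA ℂ) (VB : Matrix kB nB ℂ)
    (σ : Matrix (nA × nB × nE) (nA × nB × nE) ℂ) (K : Matrix kA kA ℂ) (L : Matrix kB kB ℂ)
    (C : Matrix nE nE ℂ) :
    ((K ⊗ₖ (L ⊗ₖ C)) * ((VA ⊗ₖ (VB ⊗ₖ (1 : Matrix nE nE ℂ))) * σ *
      (VA ⊗ₖ (VB ⊗ₖ (1 : Matrix nE nE ℂ)))ᴴ)).trace =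
      (((VAᴴ * K * VA) ⊗ₖ ((VBᴴ * L * VB) ⊗ₖ C)) * σ).trace := by
  rw [← Matrix.mul_assoc, trace_mul_comm, ← Matrix.mul_assoc, ← Matrix.mul_assoc,
    conjTranspose_kronecker, conjTranspose_kronecker, ← mul_kronecker_mul, ← mul_kronecker_mul,
    ← mul_kronecker_mul, ← mul_kronecker_mul, conjTranspose_one, Matrix.one_mul, Matrix.mul_one]

variable {X Y A B C : Type*} [Fintype X] [Fintype Y] {P : Protocol X Y A B C} {m : ℕ}

/-- The matrices that represent the variables of the relaxation. -/
def letterMatrix (EA : ∀ x, P.outA x → Matrix kA kA ℂ) (EB : ∀ y, P.outB y → Matrix kB kB ℂ)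
    (Z : ∀ x, P.outA x → Fin m → Matrix nE nE ℂ) :
    Letter P m → Matrix (kA × kB × nE) (kA × kB × nE) ℂ
  | .alice x a => EA x a ⊗ₖ ((1 : Matrix kB kB ℂ) ⊗ₖ (1 : Matrix nE nE ℂ))
  | .bob y b => (1 : Matrix kA kA ℂ) ⊗ₖ (EB y b ⊗ₖ (1 : Matrix nE nE ℂ))
  | .eve x a i => eveEmbedding kA kB nE (Z x.1 a i)
  | .eveAdj x a i => eveEmbedding kA kB nE (Z x.1 a i)ᴴ

variable {EA : ∀ x, P.outA x → Matrix kA kA ℂ} {EB : ∀ y, P.outB y → Matrix kB kB ℂ}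
    {Z : ∀ x, P.outA x → Fin m → Matrix nE nE ℂ}

lemma eveEmbedding_apply (K : Matrix nE nE ℂ) :
    eveEmbedding kA kB nE K = (1 : Matrix kA kA ℂ) ⊗ₖ ((1 : Matrix kB kB ℂ) ⊗ₖ K) := rfl

lemma letterMatrix_adj (hEA : ∀ x a, (EA x a)ᴴ = EA x a) (hEB : ∀ y b, (EB y b)ᴴ = EB y b)
    (l : Letter P m) : letterMatrix EA EB Z l.adj = (letterMatrix EA EB Z l)ᴴ := by
  cases l <;> simp [Letter.adj, letterMatrix, eveEmbedding_apply, conjTranspose_kronecker, hEA, hEB]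

lemma ncEval_letterMatrix_relation (hEA2 : ∀ x a, EA x a * EA x a = EA x a)
    (hEB2 : ∀ y b, EB y b * EB y b = EB y b) (hEAs : ∀ x, ∑ a, EA x a = 1)
    (hEBs : ∀ y, ∑ b, EB y b = 1) (k : NPARelation P m) :
    ncEval (letterMatrix EA EB Z) k.poly = 0 := by
  cases k <;>
    simp only [NPARelation.poly, ncComm, map_sub, map_sum, map_mul, map_one, ncEval_ncVar,
      letterMatrix, eveEmbedding_apply, ← finsetSum_kronecker, ← kronecker_finsetSum, hEAs, hEBs,
      one_kronecker_one, sub_self, ← mul_kronecker_mul, Matrix.one_mul, Matrix.mul_one, hEA2, hEB2]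

lemma posSemidef_of_projection {n : Type*} [Fintype n] {K : Matrix n n ℂ} (h : Kᴴ = K)
    (h2 : K * K = K) : K.PosSemidef := by
  have := posSemidef_conjTranspose_mul_self K
  rwa [h, h2] at this

/-- The value of the polynomial `P` at an operator tuple. -/
def evalP (α : ℝ) (t w : Fin m → ℝ) (K : Fin m → Matrix nE nE ℂ) : Matrix nE nE ℂ :=
  1 + (Real.sin (α * Real.pi) / Real.pi) • ∑ i, (w i / t i) •
    (1 + K i + (K i)ᴴ + (1 - t i) • ((K i)ᴴ * K i))

/-- The value of the polynomial `Q` at an operator tuple. -/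
def evalQ (α : ℝ) (w : Fin m → ℝ) (K : Fin m → Matrix nE nE ℂ) : Matrix nE nE ℂ :=
  (Real.sin (α * Real.pi) / Real.pi) • ∑ i, w i • (K i * (K i)ᴴ)

lemma ncEval_evePolyP (α : ℝ) (t w : Fin m → ℝ) (x : P.keyX) (a : P.outA x.1) :
    ncEval (letterMatrix EA EB Z) (evePolyP α t w x a) =
      eveEmbedding kA kB nE (evalP α t w (Z x.1 a)) := by
  simp only [evePolyP, evalP, map_add, map_smul, map_sum, map_mul, map_one, ncEval_ncVar,
    letterMatrix]

lemma ncEval_evePolyQ (α : ℝ) (w : Fin m → ℝ) (x : P.keyX) (a : P.outA x.1) :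
    ncEval (letterMatrix EA EB Z) (evePolyQ α w x a) =
      eveEmbedding kA kB nE (evalQ α w (Z x.1 a)) := by
  simp only [evePolyQ, evalQ, map_smul, map_sum, map_mul, ncEval_ncVar, letterMatrix]

lemma re_trace_mul_evalP_add_evalQ (α : ℝ) (t w : Fin m → ℝ) (ρ σ : Matrix nE nE ℂ)
    (K : Fin m → Matrix nE nE ℂ) :
    (ρ * evalP α t w K).trace.re + (σ * evalQ α w K).trace.re = quadratureTrace α t w ρ σ K := by
  simp only [evalP, evalQ, quadratureTrace, mul_add, mul_one, mul_smul_comm, Finset.mul_sum,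
    trace_add, trace_smul, trace_sum, Complex.add_re, Complex.smul_re, Complex.re_sum, smul_eq_mul,
    Finset.sum_add_distrib]
  ring

end Realization

/-! ### Feasible points from devices and the lower bound -/

section Feasible

open Matrix

variable {X Y A B C : Type*} [Fintype X] [DecidableEq X] [Fintype Y] [DecidableEq Y]
  [Fintype A] [DecidableEq A] [Fintype C] [DecidableEq C] {P : Protocol X Y A B C}
  {dA dB dE : ℕ}

namespace Protocol

/-- Trace one excludes dimension zero, and an empty sum cannot equal the identity there. The
dilation needs this for its default outcomes. -/
lemma nonempty_outputs (𝒟 : P.Device dA dB) (σ : NormalizedState dA dB dE) :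
    (∀ x, Nonempty (P.outA x)) ∧ ∀ y, Nonempty (P.outB y) := by
  have hne : Nonempty (Fin dA × Fin dB × Fin dE) := by
    by_contra h
    rw [not_nonempty_iff] at h
    have := σ.2.2
    simp [Matrix.trace] at this
  obtain ⟨i, j, -⟩ := hne
  refine ⟨fun x => ?_, fun y => ?_⟩
  · by_contra h
    rw [not_nonempty_iff] at h
    have := congrFun (congrFun (𝒟.M_sum x) i) i
    simp at this
  · by_contra h
    rw [not_nonempty_iff] at h
    have := congrFun (congrFun (𝒟.N_sum y) j) j
    simp at this

/-- Every device and every state, with any operators of the environment, give a feasible point of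
the relaxation. -/
theorem exists_posSemidef_momentMatrix {α : ℝ} {m : ℕ} {t w : Fin m → ℝ}
    (R : NPARelaxation P α t w) (𝒟 : P.Device dA dB) (σ : NormalizedState dA dB dE)
    (Z : ∀ x, P.outA x → Fin m → Matrix (Fin dE) (Fin dE) ℂ) :
    ∃ y : R.words → ℝ, y ⟨1, R.one_mem⟩ = 1 ∧ (R.momentMatrix y).PosSemidef ∧
      R.f y = testDataDist (P.roundOutput 𝒟 σ) ∧
      R.g y = ∑ x, P.keyProb x * ∑ a : P.outA x,
        quadratureTrace α t w (aliceState 𝒟 σ x a) (traceOutAB σ.1) (Z x a) := by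
  obtain ⟨hA, hB⟩ := nonempty_outputs 𝒟 σ
  obtain ⟨kA, _, _, VA, EA, hVA, hEA, hEA2, hEAs, hEAM⟩ :=
    exists_projective_dilation 𝒟.M 𝒟.M_pos 𝒟.M_sum
  obtain ⟨kB, _, _, VB, EB, hVB, hEB, hEB2, hEBs, hEBN⟩ :=
    exists_projective_dilation 𝒟.N 𝒟.N_pos 𝒟.N_sum
  let r := letterMatrix EA EB Z
  let J := VA ⊗ₖ (VB ⊗ₖ (1 : Matrix (Fin dE) (Fin dE) ℂ))
  let S := J * σ.1 * Jᴴ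
  have hS : S.PosSemidef := σ.2.1.mul_mul_conjTranspose_same J
  have hVA' : VAᴴ * (1 : Matrix kA kA ℂ) * VA = 1 := by rw [Matrix.mul_one, hVA]
  have hVB' : VBᴴ * (1 : Matrix kB kB ℂ) * VB = 1 := by rw [Matrix.mul_one, hVB]
  have htrace : ∀ K L C, ((K ⊗ₖ (L ⊗ₖ C)) * S).trace =
      (((VAᴴ * K * VA) ⊗ₖ ((VBᴴ * L * VB) ⊗ₖ C)) * σ.1).trace :=
    trace_kronecker_mul_dilated VA VB σ.1
  refine ⟨R.moments r S, ?_, ?_, ?_, ?_⟩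
  · have e : ncEval r (mono (1 : NCWord P m)) =
        (1 : Matrix kA kA ℂ) ⊗ₖ ((1 : Matrix kB kB ℂ) ⊗ₖ (1 : Matrix (Fin dE) (Fin dE) ℂ)) := by
      rw [ncEval_mono, map_one, one_kronecker_one, one_kronecker_one]
    rw [NPARelaxation.moments, e, htrace, hVA', hVB', one_kronecker_one, one_kronecker_one,
      Matrix.one_mul, σ.2.2, Complex.one_re]
  · refine R.posSemidef_momentMatrix (letterMatrix_adj hEA hEB) (fun x a => ?_) (fun y b => ?_)
      (ncEval_letterMatrix_relation hEA2 hEB2 hEAs hEBs) hS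
    · exact (posSemidef_of_projection (hEA x a) (hEA2 x a)).kronecker
        (PosSemidef.one.kronecker PosSemidef.one)
    · exact PosSemidef.one.kronecker
        ((posSemidef_of_projection (hEB y b) (hEB2 y b)).kronecker PosSemidef.one)
  · ext c
    rw [NPARelaxation.f, R.lin_moments r S (R.test_mem c), testDataDist_roundOutput, testPoly]
    simp only [map_sum, Finset.sum_mul, trace_sum, Complex.re_sum]
    refine Finset.sum_congr rfl fun x _ => Finset.sum_congr rfl fun y _ =>
      Finset.sum_congr rfl fun s _ => Finset.sum_congr rfl fun a _ => Finset.sum_congr rfl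
        fun b _ => ?_
    by_cases hc : P.testData a.1 b.1 x y s = c
    · have e : r (.alice x a) * r (.bob y b) = EA x a ⊗ₖ (EB y b ⊗ₖ (1 : Matrix (Fin dE) (Fin dE) ℂ)) := by
        simp only [r, letterMatrix, ← mul_kronecker_mul, Matrix.one_mul, Matrix.mul_one]
      rw [if_pos hc, if_pos hc, map_smul, map_mul, ncEval_ncVar, ncEval_ncVar, e, smul_mul_assoc,
        trace_smul, Complex.smul_re, htrace, hEAM, hEBN, smul_eq_mul]
    · rw [if_neg hc, if_neg hc, map_zero, Matrix.zero_mul, trace_zero, Complex.zero_re, mul_zero]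
  · rw [NPARelaxation.g, R.lin_moments r S R.entropy_mem, entropyPoly]
    simp only [map_sum, map_smul, map_add, map_mul, Finset.sum_mul, smul_mul_assoc, trace_sum,
      trace_smul, Complex.re_sum, Complex.smul_re, smul_eq_mul]
    have hterm : ∀ (x : P.keyX) (a : P.outA x.1),
        ((ncEval r (ncVar (.alice x.1 a)) * ncEval r (evePolyP α t w x a) +
          ncEval r (evePolyQ α w x a)) * S).trace.re =
        quadratureTrace α t w (aliceState 𝒟 σ x.1 a) (traceOutAB σ.1) (Z x.1 a) := by
      intro x a
      have e1 : EA x.1 a ⊗ₖ ((1 : Matrix kB kB ℂ) ⊗ₖ (1 : Matrix (Fin dE) (Fin dE) ℂ)) *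
          eveEmbedding kA kB (Fin dE) (evalP α t w (Z x.1 a)) =
          EA x.1 a ⊗ₖ ((1 : Matrix kB kB ℂ) ⊗ₖ evalP α t w (Z x.1 a)) := by
        simp only [eveEmbedding_apply, ← mul_kronecker_mul, Matrix.one_mul, Matrix.mul_one]
      have e2 : ncEval r (ncVar (.alice x.1 a)) = EA x.1 a ⊗ₖ ((1 : Matrix kB kB ℂ) ⊗ₖ
          (1 : Matrix (Fin dE) (Fin dE) ℂ)) := ncEval_ncVar _ _
      -- The factor `M_{a|x}` in front of `P(Z)` leaves Alice's conditional state, whereas `Q(Z)`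
      -- has no such factor and meets Eve's full reduced state.
      rw [e2, ncEval_evePolyP, ncEval_evePolyQ, e1, eveEmbedding_apply, Matrix.add_mul, trace_add,
        Complex.add_re, htrace, htrace, hVA', hVB', hEAM, ← trace_traceOutAB_mul,
        trace_one_kronecker_mul, ← re_trace_mul_evalP_add_evalQ]
      rfl
    simp only [hterm]
    refine (Finset.sum_coe_sort P.keyX fun x => P.keyProb x * ∑ a : P.outA x,
      quadratureTrace α t w (aliceState 𝒟 σ x a) (traceOutAB σ.1) (Z x a)).trans ?_
    refine Finset.sum_subset (Finset.subset_univ _) fun x _ hx => ?_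
    rw [P.keyProb_eq_zero hx, zero_mul]

/-- The relaxation is a lower bound. -/
theorem value_le_roundValue {α : ℝ} (hα : α ∈ Set.Ioo (1 : ℝ) 2) {m : ℕ} (hm : 1 ≤ m)
    {t w : Fin m → ℝ} (h : IsGaussRadauJacobi α t w) (R : NPARelaxation P α t w)
    {SΩ : Set (Option C → ℝ)} (hSΩ : SΩ ⊆ stdSimplex ℝ (Option C)) :
    R.value SΩ ≤ P.roundValue α SΩ := by
  -- This also covers an empty acceptance set, whose real infimum is `0`.
  have hq0 : 0 ≤ qMin SΩ := by
    refine Real.sInf_nonneg ?_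
    rintro _ ⟨q, hq, rfl⟩
    exact (hSΩ hq).1 none
  have hα1 : 0 < α - 1 := by linarith [hα.1]
  refine le_iInf fun dA => le_iInf fun dB => le_iInf fun dE => le_iInf fun 𝒟 => le_iInf fun q =>
    le_iInf fun hq => le_iInf fun σ => ?_
  obtain ⟨r, hr, hent, Z, hZ⟩ := exists_keyEntropy_bound hα hm h 𝒟 σ
  obtain ⟨y, hy1, hyM, hyf, hyg⟩ := exists_posSemidef_momentMatrix R 𝒟 σ Z
  rw [← hyg] at hZ
  refine (iInf₂_le (q, y) ⟨hq, hy1, hyM⟩).trans ?_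
  rw [NPARelaxation.objective, roundObjective, hyf, hent]
  refine add_le_add_right ?_ _
  rw [elogTwo, if_pos (hr.trans_le hZ), ← EReal.coe_mul, ← EReal.coe_mul, EReal.coe_le_coe_iff]
  have hlog : Real.logb 2 r ≤ Real.logb 2 (R.g y) := Real.logb_le_logb_of_le one_lt_two hr hZ
  have e : qMin SΩ / (1 - α) * Real.logb 2 (R.g y) =
      qMin SΩ * -(1 / (α - 1) * Real.logb 2 (R.g y)) := by
    rw [← neg_sub α 1, div_neg]; ring
  rw [e]
  exact mul_le_mul_of_nonneg_left (neg_le_neg (mul_le_mul_of_nonneg_left hlog (by positivity))) hq0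

end Protocol

end Feasible

/-! ### Convexity of the relaxed program -/

section Convexity

lemma ereal_coe_mul_ne_bot {a : ℝ} (ha : 0 < a) {x : EReal} (hx : x ≠ ⊥) : (a : EReal) * x ≠ ⊥ := by
  induction x with
  | bot => exact absurd rfl hx
  | top => rw [EReal.coe_mul_top_of_pos ha]; exact top_ne_bot
  | coe x => rw [← EReal.coe_mul]; exact EReal.coe_ne_bot _

lemma relEntropyTerm_ne_bot (q p : ℝ) : relEntropyTerm q p ≠ ⊥ := by
  unfold relEntropyTerm
  split_ifs
  · exact EReal.coe_ne_bot _
  · exact EReal.zero_ne_bot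
  · exact top_ne_bot

/-- The log-sum inequality, for two summands. -/
lemma log_sum_two {q₁ q₂ p₁ p₂ : ℝ} (hq₁ : 0 < q₁) (hq₂ : 0 < q₂) (hp₁ : 0 < p₁) (hp₂ : 0 < p₂) :
    (q₁ + q₂) * Real.logb 2 ((q₁ + q₂) / (p₁ + p₂)) ≤
      q₁ * Real.logb 2 (q₁ / p₁) + q₂ * Real.logb 2 (q₂ / p₂) := by
  have h2 : 0 < Real.log 2 := Real.log_pos one_lt_two
  -- The tangent bound `log u ≤ u - 1` is used at the ratio of the total quotient to `q / p`; the
  -- two right-hand sides add up to zero.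
  have key : ∀ {q p : ℝ}, 0 < q → 0 < p →
      q * Real.log ((q₁ + q₂) / (p₁ + p₂)) - q * Real.log (q / p) ≤
        p * ((q₁ + q₂) / (p₁ + p₂)) - q := by
    intro q p hq hp
    have hs : 0 < (q₁ + q₂) / (p₁ + p₂) := by positivity
    have h := mul_le_mul_of_nonneg_left
      (Real.log_le_sub_one_of_pos (div_pos hs (div_pos hq hp))) hq.le
    rw [Real.log_div hs.ne' (div_pos hq hp).ne'] at h
    have e : q * ((q₁ + q₂) / (p₁ + p₂) / (q / p) - 1) = p * ((q₁ + q₂) / (p₁ + p₂)) - q := by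
      field_simp
    rw [← e, ← mul_sub]
    exact h
  have h := add_le_add (key hq₁ hp₁) (key hq₂ hp₂)
  have e : p₁ * ((q₁ + q₂) / (p₁ + p₂)) - q₁ + (p₂ * ((q₁ + q₂) / (p₁ + p₂)) - q₂) = 0 := by
    field_simp
    ring
  simp only [Real.logb, ← mul_div_assoc, ← add_div]
  rw [div_le_div_iff_of_pos_right h2]
  linarith

lemma relEntropyTerm_smul {a : ℝ} (ha : 0 < a) (q p : ℝ) :
    relEntropyTerm (a * q) (a * p) = (a : EReal) * relEntropyTerm q p := by
  unfold relEntropyTerm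
  simp only [mul_pos_iff_of_pos_left ha, mul_nonneg_iff_of_pos_left ha, mul_eq_zero, ha.ne',
    false_or]
  split_ifs
  · rw [mul_div_mul_left _ _ ha.ne', mul_assoc, EReal.coe_mul]
  · rw [mul_zero]
  · rw [EReal.coe_mul_top_of_pos ha]

/-- Infinite terms are harmless, as no term is `⊥`. Two positive terms fall under the log-sum
inequality; if one `q` vanishes, its `p` only enlarges the other denominator. -/
lemma relEntropyTerm_add_le (q₁ q₂ p₁ p₂ : ℝ) :
    relEntropyTerm (q₁ + q₂) (p₁ + p₂) ≤ relEntropyTerm q₁ p₁ + relEntropyTerm q₂ p₂ := by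
  have hdom : ∀ {q p : ℝ}, relEntropyTerm q p ≠ ⊤ → (0 < q ∧ 0 < p) ∨ (q = 0 ∧ 0 ≤ p) := by
    intro q p h
    unfold relEntropyTerm at h
    split_ifs at h with h1 h2
    · exact Or.inl h1
    · exact Or.inr h2
    · exact absurd rfl h
  have hmono : ∀ {q p r : ℝ}, 0 < q → 0 < p → 0 ≤ r →
      relEntropyTerm q (p + r) ≤ relEntropyTerm q p := by
    intro q p r hq hp hr
    rw [relEntropyTerm, relEntropyTerm, if_pos ⟨hq, by linarith⟩, if_pos ⟨hq, hp⟩,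
      EReal.coe_le_coe_iff]
    refine mul_le_mul_of_nonneg_left (Real.logb_le_logb_of_le one_lt_two (by positivity) ?_) hq.le
    gcongr
    linarith
  have hzero : ∀ {p : ℝ}, 0 ≤ p → relEntropyTerm 0 p = 0 := by
    intro p hp
    simp [relEntropyTerm, hp]
  by_cases h1 : relEntropyTerm q₁ p₁ = ⊤
  · rw [h1, EReal.top_add_of_ne_bot (relEntropyTerm_ne_bot _ _)]
    exact le_top
  by_cases h2 : relEntropyTerm q₂ p₂ = ⊤
  · rw [h2, EReal.add_top_of_ne_bot (relEntropyTerm_ne_bot _ _)]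
    exact le_top
  rcases hdom h1 with ⟨hq₁, hp₁⟩ | ⟨rfl, hp₁⟩ <;> rcases hdom h2 with ⟨hq₂, hp₂⟩ | ⟨rfl, hp₂⟩
  · rw [relEntropyTerm, relEntropyTerm, relEntropyTerm,
      if_pos ⟨add_pos hq₁ hq₂, add_pos hp₁ hp₂⟩, if_pos ⟨hq₁, hp₁⟩, if_pos ⟨hq₂, hp₂⟩, ← EReal.coe_add, EReal.coe_le_coe_iff]
    exact log_sum_two hq₁ hq₂ hp₁ hp₂
  · rw [hzero hp₂, add_zero, add_zero]
    exact hmono hq₁ hp₁ hp₂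
  · rw [hzero hp₁, zero_add, zero_add, add_comm]
    exact hmono hq₂ hp₂ hp₁
  · rw [hzero hp₁, hzero hp₂, add_zero, add_zero, hzero (add_nonneg hp₁ hp₂)]

section

variable {ι : Type*} [Fintype ι]

lemma relEntropy_smul {a : ℝ} (ha : 0 < a) (q p : ι → ℝ) :
    relEntropy (a • q) (a • p) = (a : EReal) * relEntropy q p := by
  classical
  simp only [relEntropy, Pi.smul_apply, smul_eq_mul, relEntropyTerm_smul ha]
  refine Finset.induction_on Finset.univ (by simp) fun c s hc ih => ?_
  rw [Finset.sum_insert hc, Finset.sum_insert hc, ih, EReal.left_distrib_of_nonneg_of_ne_top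
    (EReal.coe_nonneg.2 ha.le) (EReal.coe_ne_top _)]

/-- The relative entropy is sublinear, hence jointly convex. -/
lemma relEntropy_add_le (q₁ q₂ p₁ p₂ : ι → ℝ) :
    relEntropy (q₁ + q₂) (p₁ + p₂) ≤ relEntropy q₁ p₁ + relEntropy q₂ p₂ := by
  unfold relEntropy
  rw [← Finset.sum_add_distrib]
  exact Finset.sum_le_sum fun c _ => relEntropyTerm_add_le _ _ _ _

end

lemma coe_mul_elogTwo_ne_bot {k : ℝ} (hk : k ≤ 0) (s : ℝ) : (k : EReal) * elogTwo s ≠ ⊥ := by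
  unfold elogTwo
  split_ifs
  · rw [← EReal.coe_mul]; exact EReal.coe_ne_bot _
  · rcases hk.eq_or_lt with rfl | hk
    · simp
    · rw [EReal.coe_mul_bot_of_neg hk]; exact top_ne_bot

/-- A nonpositive multiple of the logarithm is convex. -/
lemma coe_mul_elogTwo_convex {k : ℝ} (hk : k ≤ 0) (s r : ℝ) {a b : ℝ} (ha : 0 < a) (hb : 0 < b)
    (hab : a + b = 1) :
    (k : EReal) * elogTwo (a * s + b * r) ≤
      (a : EReal) * ((k : EReal) * elogTwo s) + (b : EReal) * ((k : EReal) * elogTwo r) := by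
  -- For `k = 0` all terms vanish, since `0 * ⊥ = 0`; for `k < 0` an argument outside `(0, ∞)` makes
  -- the right side `⊤`.
  rcases hk.eq_or_lt with rfl | hk'
  · simp
  have hbot : ∀ {c u : ℝ}, 0 < c → ¬ 0 < u → (c : EReal) * ((k : EReal) * elogTwo u) = ⊤ := by
    intro c u hc hu
    rw [elogTwo, if_neg hu, EReal.coe_mul_bot_of_neg hk', EReal.coe_mul_top_of_pos hc]
  by_cases hs : 0 < s
  swap
  · rw [hbot ha hs, EReal.top_add_of_ne_bot
      (ereal_coe_mul_ne_bot hb (coe_mul_elogTwo_ne_bot hk r))]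
    exact le_top
  by_cases hr : 0 < r
  swap
  · rw [hbot hb hr, EReal.add_top_of_ne_bot
      (ereal_coe_mul_ne_bot ha (coe_mul_elogTwo_ne_bot hk s))]
    exact le_top
  rw [elogTwo, elogTwo, elogTwo, if_pos hs, if_pos hr, if_pos (by positivity)]
  simp only [← EReal.coe_mul, ← EReal.coe_add]
  rw [EReal.coe_le_coe_iff]
  have hc := strictConcaveOn_log_Ioi.concaveOn.2 hs hr ha.le hb.le hab
  simp only [smul_eq_mul] at hc
  have h2 : 0 < Real.log 2 := Real.log_pos one_lt_two
  have hc' : a * Real.logb 2 s + b * Real.logb 2 r ≤ Real.logb 2 (a * s + b * r) := by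
    simp only [Real.logb, ← mul_div_assoc, ← add_div]
    exact div_le_div_of_nonneg_right hc h2.le
  nlinarith [mul_le_mul_of_nonpos_left hc' hk]

section

variable {X Y A B C : Type*} [Fintype X] [Fintype Y] {P : Protocol X Y A B C} {m : ℕ}
  {α : ℝ} {t w : Fin m → ℝ}

namespace NPARelaxation

variable (R : NPARelaxation P α t w)

lemma lin_add_smul (p : NCPoly P m) (a b : ℝ) (y z : R.words → ℝ) :
    R.lin p (a • y + b • z) = a * R.lin p y + b * R.lin p z := by
  simp only [lin, Finset.mul_sum, ← Finset.sum_add_distrib, Pi.add_apply, Pi.smul_apply,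
    smul_eq_mul]
  exact Finset.sum_congr rfl fun u _ => by ring

lemma momentMatrix_add_smul (a b : ℝ) (y z : R.words → ℝ) :
    R.momentMatrix (a • y + b • z) = a • R.momentMatrix y + b • R.momentMatrix z := by
  classical
  simp only [momentMatrix]
  rw [← Matrix.blockDiagonal'_smul, ← Matrix.blockDiagonal'_smul, ← Matrix.blockDiagonal'_add]
  congr 1
  ext j u v
  exact R.lin_add_smul _ a b y z

lemma convex_feasible {SΩ : Set (Option C → ℝ)} (hconv : Convex ℝ SΩ) :
    Convex ℝ (R.feasible SΩ) := by
  rintro ⟨q, y⟩ ⟨hq, hy, hM⟩ ⟨q', y'⟩ ⟨hq', hy', hM'⟩ a b ha hb hab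
  refine ⟨hconv hq hq' ha hb hab, ?_, ?_⟩
  · change a * y ⟨1, R.one_mem⟩ + b * y' ⟨1, R.one_mem⟩ = 1
    change y _ = 1 at hy
    change y' _ = 1 at hy'
    rw [hy, hy', mul_one, mul_one, hab]
  · change (R.momentMatrix (a • y + b • y')).PosSemidef
    rw [momentMatrix_add_smul]
    exact (hM.smul ha).add (hM'.smul hb)

/-- Sublinearity gives joint convexity of the divergence in `(q, f(y))`; the coefficient of the
logarithm is nonpositive because `qMin SΩ ≥ 0` and `α > 1`. -/
theorem isConvexProgram [Fintype C] (hα : 1 < α) {SΩ : Set (Option C → ℝ)}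
    (hq : 0 ≤ qMin SΩ) (hconv : Convex ℝ SΩ) :
    IsConvexProgram (R.feasible SΩ) (R.objective SΩ) := by
  refine ⟨R.convex_feasible hconv, ?_⟩
  rintro ⟨q, y⟩ - ⟨q', y'⟩ - a b ha hb hab
  have hk : qMin SΩ / (1 - α) ≤ 0 := div_nonpos_of_nonneg_of_nonpos hq (by linarith)
  have hc : 0 < 1 / (α - 1) := one_div_pos.2 (by linarith)
  have dist : ∀ {c : ℝ}, 0 < c → ∀ x z : EReal, (c : EReal) * (x + z) = c * x + c * z :=
    fun hc x z => EReal.left_distrib_of_nonneg_of_ne_top (EReal.coe_nonneg.2 hc.le)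
      (EReal.coe_ne_top _) x z
  have hf : R.f (a • y + b • y') = a • R.f y + b • R.f y' :=
    funext fun c => R.lin_add_smul _ a b y y'
  have hg : R.g (a • y + b • y') = a * R.g y + b * R.g y' := R.lin_add_smul _ a b y y'
  have h1 := relEntropy_add_le (a • q) (b • q') (a • R.f y) (b • R.f y')
  rw [relEntropy_smul ha, relEntropy_smul hb] at h1
  have h2 := add_le_add (mul_le_mul_of_nonneg_left h1 (EReal.coe_nonneg.2 hc.le))
    (coe_mul_elogTwo_convex hk (R.g y) (R.g y') ha hb hab)
  change ((1 / (α - 1) : ℝ) : EReal) * relEntropy (a • q + b • q') (R.f (a • y + b • y')) +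
    ((qMin SΩ / (1 - α) : ℝ) : EReal) * elogTwo (R.g (a • y + b • y')) ≤ _
  rw [hf, hg]
  refine h2.trans (le_of_eq ?_)
  rw [objective, objective, dist ha, dist hb, dist hc, add_add_add_comm,
    mul_left_comm _ (a : EReal), mul_left_comm _ (b : EReal)]

end NPARelaxation

end

end Convexity

end

theorem theorem7 {X Y A B C : Type*} [Fintype X] [DecidableEq X] [Fintype Y] [DecidableEq Y]
    [Fintype A] [DecidableEq A] [Fintype C] [DecidableEq C]
    (P : Protocol X Y A B C) (SΩ : Set (Option C → ℝ)) (hSΩ : SΩ ⊆ stdSimplex ℝ (Option C))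
    (α : ℝ) (hα : α ∈ Set.Ioo (1 : ℝ) 2) (m : ℕ) (hm : 1 ≤ m) :
    (∃ t w : Fin m → ℝ, IsGaussRadauJacobi α t w) ∧
    ∀ t w : Fin m → ℝ, IsGaussRadauJacobi α t w →
      (∀ i, t i ∈ Set.Ioc (0 : ℝ) 1 ∧ 0 < w i) ∧
      ∀ R : NPARelaxation P α t w,
        R.value SΩ ≤ P.roundValue α SΩ ∧
        (Convex ℝ SΩ → IsConvexProgram (R.feasible SΩ) (R.objective SΩ)) := by
  refine ⟨exists_isGaussRadauJacobi hα hm, fun t w h =>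
    ⟨fun i => ⟨⟨h.node_pos hα i, h.le_one i⟩, h.weight_pos hα i⟩, fun R =>
      ⟨Protocol.value_le_roundValue hα hm h R hSΩ, R.isConvexProgram hα.1 ?_⟩⟩⟩
  refine Real.sInf_nonneg ?_
  rintro _ ⟨q, hq, rfl⟩
  exact (hSΩ hq).1 none
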